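/- Let $N\ge 0$ and let $R(k_1,k_2)$, $k_1,k_2\in\mathbb R$, be complex $N^2\times N^2$ matrices (with no assumption on the dependence on $k_1,k_2$) satisfying, for all spectral parameters, the Yang–Baxter equation $R_{12}(k_1,k_2)R_{13}(k_1,k_3)R_{23}(k_2,k_3)=R_{23}(k_2,k_3)R_{13}(k_1,k_3)R_{12}(k_1,k_2)$ and the unitarity condition $R_{12}(k_1,k_2)R_{21}(k_2,k_1)=\mathbb I\otimes\mathbb I$. Let $\mathcal A_R$ be the (completed) ZF algebra, with generators $a_i(k),a_i^\dagger(k)$, $1\le i\le N$, and relations $$a_1(k_1)a_2(k_2)=R_{21}(k_2,k_1)a_2(k_2)a_1(k_1),\qquad a_1^\dagger(k_1)a_2^\dagger(k_2)=a_2^\dagger(k_2)a_1^\dagger(k_1)R_{21}(k_2,k_1),$$ $$a_1(k_1)a_2^\dagger(k_2)=a_2^\dagger(k_2)R_{12}(k_1,k_2)a_1(k_1)+\delta(k_1-k_2)\delta_{12},$$ where $a=\sum_i a_i e_i$, $a^\dagger=\sum_i a^\dagger_i e_i^\dagger$, $\delta_{12}=\sum_i e_i\otimes e_i^\dagger$.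 It is realized on its Fock space, the space of arrays of amplitudes $\langle\Omega,a_{i_n}(k_n)\cdots a_{i_1}(k_1)\varphi\rangle$, $n\ge0$, having the exchange symmetry dictated by the first relation; $a_i^\dagger(k)$ is a distribution in $k$, and $\mathcal A_R$ consists of the operators obtained from the $a_i(k)$ and scalars by sums, products, integrals $\int dk\sum_i a_i^\dagger(k)X_i(k)$ with $X_i(k)\in\mathcal A_R$, and limits of sequences for which each amplitude is eventually constant. For a family of matrices $C^{(n)}_{01\ldots n}(k_0,\ldots,k_n)$ on $(\mathbb C^N)^{\otimes(n+1)}$, $n\ge1$, put $$V_C(k_0)=\mathbb I+\sum_{n\ge1}\frac{(-1)^n}{(n-1)!}\int dk_1\cdots dk_n\; a^\dagger_{n\ldots1}\,C^{(n)}_{01\ldots n}\,a_{1\ldots n},$$ with $a_{1\ldots n}=a_1(k_1)\cdots a_n(k_n)$ and $a^\dagger_{n\ldots1}=a_n^\dagger(k_n)\cdots a_1^\dagger(k_1)$; on each amplitude the sum is finite. Let $T(k_0)=V_T(k_0)$ with $$T^{(n)}_{01\ldots n}=\frac1n\sum_{m=0}^n(-1)^m\binom nm R_{0,n}(k_0,k_n)R_{0,n-1}(k_0,k_{n-1})\cdots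 R_{0,n-m+1}(k_0,k_{n-m+1}).$$ A matrix $L(k)\in\mathcal A_R\otimes M_N(\mathbb C)$ is called well-bred if $L_1(k_1)a_2(k_2)=R_{21}(k_2,k_1)a_2(k_2)L_1(k_1)$ and $L_1(k_1)a_2^\dagger(k_2)=a_2^\dagger(k_2)R_{12}(k_1,k_2)L_1(k_1)$. Then: 1. $T(k)$ is well-bred, and it is the only well-bred operator among the series $V_C(k)$. 2. $T(k)$ satisfies $R_{12}(k_1,k_2)T_1(k_1)T_2(k_2)=T_2(k_2)T_1(k_1)R_{12}(k_1,k_2)$ for all $k_1,k_2$. Hence there is an algebra homomorphism to $\mathcal A_R$ from the algebra $\mathcal U_R$ generated by symbols $T_{ij}(k)$ ($1\le i,j\le N$, $k\in\mathbb R$) subject to this relation, which sends the generators to the entries of the vertex operator. 3. $T^\dagger(k)=T(k)^{-1}$, i.e. $T(k)T^\dagger(k)=T^\dagger(k)T(k)=\mathbb I$, where $T^\dagger(k_0)=V_{T^\dagger}(k_0)$ has the coefficients $T^{(n)\dagger}$ obtained from $T^{(n)}$ by reversing products and setting $R_{12}(k_1,k_2)^\dagger=R_{21}(k_2,k_1)$.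 If $R_{21}(k_2,k_1)$ is the Hermitian conjugate matrix of $R_{12}(k_1,k_2)$ for all $k_1,k_2$, then $T^{(n)\dagger}$ is the Hermitian conjugate of $T^{(n)}$, and the operator $(T^\dagger)_{ji}(k)$ is adjoint to $T_{ij}(k)$ for the scalar product $\sum_n\frac1{n!}\int dk_1\cdots dk_n\sum_\alpha\overline{\varphi}\,\psi$ on Fock vectors with finitely many particles and measurable square integrable amplitudes. -/

import Mathlib

open scoped Matrix Kronecker ComplexConjugate

noncomputable section

namespace ZF

/-! ### The `R`-matrix -/

/-- Matrices acting on the tensor square of `ℂ^N`; the entry `M (i, j) (i', j')` is the coefficient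
of `E_{i i'} ⊗ E_{j j'}`. -/
abbrev TwoBody (N : ℕ) := Matrix (Fin N × Fin N) (Fin N × Fin N) ℂ

/-- For `p ≠ q`, the matrix `M_{pq}` on `⨂_{r ∈ ι} ℂ^N` which acts as `M` on the copies `p` (first
tensor factor of `M`) and `q` (second tensor factor of `M`) and as the identity on the others. In
particular `leg M 1 0` on two copies is `M_{21}`. -/
def leg {N : ℕ} {ι : Type} [Fintype ι] [DecidableEq ι] (M : TwoBody N) (p q : ι) :
    Matrix (ι → Fin N) (ι → Fin N) ℂ :=
  fun α β => if ∀ r, r ≠ p → r ≠ q → α r = β r then M (α p, α q) (β p, β q) else 0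

/-- An evaluated `R`-matrix `R(k₁, k₂)`, of size `N² × N²`, with real spectral parameters, subject to
the Yang-Baxter equation and to the unitarity condition. Nothing is assumed on the dependence on the
spectral parameters. -/
structure RMatrix (N : ℕ) where
  /-- the matrix `R(k₁, k₂)` -/
  mat : ℝ → ℝ → TwoBody N
  /-- `R₁₂(k₁,k₂) R₁₃(k₁,k₃) R₂₃(k₂,k₃) = R₂₃(k₂,k₃) R₁₃(k₁,k₃) R₁₂(k₁,k₂)` -/
  yangBaxter : ∀ k₁ k₂ k₃ : ℝ,
    leg (mat k₁ k₂) (0 : Fin 3) 1 * leg (mat k₁ k₃) (0 : Fin 3) 2 * leg (mat k₂ k₃) (1 : Fin 3) 2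
      = leg (mat k₂ k₃) (1 : Fin 3) 2 * leg (mat k₁ k₃) (0 : Fin 3) 2
          * leg (mat k₁ k₂) (0 : Fin 3) 1
  /-- `R₁₂(k₁,k₂) R₂₁(k₂,k₁) = 𝕀 ⊗ 𝕀` -/
  unitarity : ∀ k₁ k₂ : ℝ,
    leg (mat k₁ k₂) (0 : Fin 2) 1 * leg (mat k₂ k₁) (1 : Fin 2) 0 = 1

/-! Component forms of the two conditions. -/

theorem leg_mulVec {N : ℕ} {ι : Type} [Fintype ι] [DecidableEq ι] (M : TwoBody N) {p q : ι}
    (h : p ≠ q) (v : (ι → Fin N) → ℂ) (α : ι → Fin N) :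
    (leg M p q *ᵥ v) α = ∑ c, ∑ d, M (α p, α q) (c, d)
      * v (Function.update (Function.update α p c) q d) := by
  classical
  rw [Matrix.mulVec, dotProduct, ← Fintype.sum_prod_type']
  symm
  apply Finset.sum_of_injOn
    (fun x : Fin N × Fin N => Function.update (Function.update α p x.1) q x.2)
  · intro x _ y _ hxy
    have h1 := congrFun hxy p
    have h2 := congrFun hxy q
    simp [h] at h1 h2
    exact Prod.ext h1 h2
  · simp
  · intro β _ hβ
    simp only [leg]
    rw [if_neg, zero_mul]
    intro hr
    apply hβ
    refine ⟨(β p, β q), by simp, ?_⟩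
    funext r
    by_cases hq : r = q
    · subst hq; simp
    · by_cases hp : r = p
      · subst hp; simp [hq]
      · simp [hp, hq, hr r hp hq]
  · intro x _
    simp only [leg]
    rw [if_pos]
    · simp [h]
    · intro r hp hq
      simp [hp, hq]

theorem RMatrix.unit_comp {N : ℕ} (R : RMatrix N) (p q : ℝ) (a b : Fin N)
    (w : Fin N → Fin N → ℂ) :
    ∑ c, ∑ d, R.mat p q (a, b) (c, d) * ∑ d', ∑ c', R.mat q p (d, c) (d', c') * w c' d' = w a b := by
  have h := congrArg (fun M => (M *ᵥ (fun α => w (α 0) (α 1))) ![a, b]) (R.unitarity p q)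
  simp only [← Matrix.mulVec_mulVec, Matrix.one_mulVec] at h
  rw [leg_mulVec _ (by decide)] at h
  simp only [leg_mulVec _ (show (1 : Fin 2) ≠ 0 by decide)] at h
  simpa using h

theorem RMatrix.ybe_comp {N : ℕ} (R : RMatrix N) (p q r : ℝ) (a b j : Fin N)
    (w : Fin N → Fin N → Fin N → ℂ) :
    ∑ c, ∑ d, R.mat p q (a, b) (c, d) * ∑ c', ∑ j', R.mat p r (c, j) (c', j')
        * ∑ d', ∑ j'', R.mat q r (d, j') (d', j'') * w c' d' j''
      = ∑ b', ∑ j', R.mat q r (b, j) (b', j') * ∑ a', ∑ j'', R.mat p r (a, j') (a', j'')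
        * ∑ c', ∑ d', R.mat p q (a', b') (c', d') * w c' d' j'' := by
  have h := congrArg (fun M => (M *ᵥ (fun α => w (α 0) (α 1) (α 2))) ![a, b, j])
    (R.yangBaxter p q r)
  simp only [← Matrix.mulVec_mulVec] at h
  simp only [leg_mulVec _ (show (0 : Fin 3) ≠ 1 by decide),
    leg_mulVec _ (show (0 : Fin 3) ≠ 2 by decide),
    leg_mulVec _ (show (1 : Fin 3) ≠ 2 by decide)] at h
  simpa [Function.update_apply] using h

/-! ### The Fock space -/

/-- Arrays of amplitudes: `φ [(k₁, i₁), …, (k_n, i_n)]` stands for the `n`-particle amplitude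
`⟨Ω, a_{i_n}(k_n) ⋯ a_{i_1}(k_1) φ⟩`. -/
abbrev Amp (N : ℕ) := List (ℝ × Fin N) → ℂ

/-- The Fock space `𝓕_R` (all particle numbers, without any restriction on the dependence of the
amplitudes on the spectral parameters): arrays of amplitudes with the exchange property dictated by
`a₁(k₁) a₂(k₂) = R₂₁(k₂,k₁) a₂(k₂) a₁(k₁)`. -/
def Fock {N : ℕ} (R : RMatrix N) : Submodule ℂ (Amp N) where
  carrier := {φ | ∀ (l l' : List (ℝ × Fin N)) (p q : ℝ) (a b : Fin N),
    φ (l ++ (p, a) :: (q, b) :: l')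
      = ∑ c, ∑ d, R.mat p q (a, b) (c, d) * φ (l ++ (q, d) :: (p, c) :: l')}
  zero_mem' := by intro l l' p q a b; simp
  add_mem' := by
    intro x y hx hy l l' p q a b
    simp only [Pi.add_apply, mul_add, Finset.sum_add_distrib]
    rw [hx, hy]
  smul_mem' := by
    intro c x hx l l' p q a b
    simp only [Pi.smul_apply, smul_eq_mul, mul_left_comm _ c, ← Finset.mul_sum]
    rw [hx]

/-- The vacuum `Ω`. -/
def vacuum {N : ℕ} (R : RMatrix N) : Fock R :=
  ⟨fun l => if l = [] then 1 else 0, by intro l l' p q a b; simp⟩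

/-- The annihilation operator `a_i(k)`. -/
def annihEnd {N : ℕ} (R : RMatrix N) (k : ℝ) (i : Fin N) : Module.End ℂ (Fock R) where
  toFun φ := ⟨fun l => φ.1 ((k, i) :: l), fun l l' p q a b => φ.2 ((k, i) :: l) l' p q a b⟩
  map_add' _ _ := rfl
  map_smul' _ _ := rfl

/-- The amplitudes of `∫ dk ∑_i a†_i(k) F_i(k)`. They are obtained by letting the annihilation
operators act from the left: there is no vacuum component, and
`a_i(k) ∫ dp ∑_j a†_j(p) F_j(p)
  = F_i(k) + ∫ dp ∑_{j, i', j'} a†_j(p) R(k,p)_{(i,j),(i',j')} a_{i'}(k) F_{j'}(p)`. -/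
def createAmp {N : ℕ} (R : RMatrix N) : List (ℝ × Fin N) → (ℝ → Fin N → Amp N) → ℂ
  | [], _ => 0
  | (k, i) :: l, F => F k i l + createAmp R l (fun p j l' =>
      ∑ i', ∑ j', R.mat k p (i, j) (i', j') * F p j' ((k, i') :: l'))

theorem createAmp_add {N : ℕ} (R : RMatrix N) (l : List (ℝ × Fin N)) :
    ∀ F G : ℝ → Fin N → Amp N,
      createAmp R l (fun p j l' => F p j l' + G p j l') = createAmp R l F + createAmp R l G := by
  induction l with
  | nil => intro F G; simp [createAmp]
  | cons x l ih =>
    obtain ⟨k, i⟩ := x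
    intro F G
    simp only [createAmp, mul_add, Finset.sum_add_distrib]
    rw [ih]
    ring

theorem createAmp_smul {N : ℕ} (R : RMatrix N) (l : List (ℝ × Fin N)) (c : ℂ) :
    ∀ F : ℝ → Fin N → Amp N,
      createAmp R l (fun p j l' => c * F p j l') = c * createAmp R l F := by
  induction l with
  | nil => intro F; simp [createAmp]
  | cons x l ih =>
    obtain ⟨k, i⟩ := x
    intro F
    simp only [createAmp, mul_left_comm _ c, ← Finset.mul_sum]
    rw [ih]
    ring

theorem createAmp_sum {N : ℕ} (R : RMatrix N) (l : List (ℝ × Fin N)) {ι : Type} (s : Finset ι)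
    (F : ι → ℝ → Fin N → Amp N) :
    createAmp R l (fun p j l' => ∑ x ∈ s, F x p j l') = ∑ x ∈ s, createAmp R l (F x) := by
  classical
  induction s using Finset.induction_on with
  | empty =>
    simp only [Finset.sum_empty]
    have := createAmp_smul R l 0 (fun _ _ _ => 0)
    simpa using this
  | insert x s hx ih =>
    simp only [Finset.sum_insert hx]
    rw [createAmp_add, ih]

theorem createAmp_exchange {N : ℕ} (R : RMatrix N) (l' : List (ℝ × Fin N)) (p q : ℝ)
    (a b : Fin N) (l : List (ℝ × Fin N)) :
    ∀ F : ℝ → Fin N → Amp N, (∀ r j, F r j ∈ Fock R) →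
      createAmp R (l ++ (p, a) :: (q, b) :: l') F
        = ∑ c, ∑ d, R.mat p q (a, b) (c, d) * createAmp R (l ++ (q, d) :: (p, c) :: l') F := by
  induction l with
  | nil =>
    intro F hF
    simp only [List.nil_append, createAmp, mul_add, Finset.sum_add_distrib]
    have h1 := R.unit_comp p q a b (fun c' d' => F p c' ((q, d') :: l'))
    have h2 : createAmp R l' (fun r j l'' => ∑ b', ∑ j', R.mat q r (b, j) (b', j') *
          ∑ a', ∑ j'', R.mat p r (a, j') (a', j'') * F r j'' ((p, a') :: (q, b') :: l''))
        = ∑ c, ∑ d, R.mat p q (a, b) (c, d) * createAmp R l' (fun r j l'' =>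
            ∑ c', ∑ j', R.mat p r (c, j) (c', j') *
              ∑ d', ∑ j'', R.mat q r (d, j') (d', j'') * F r j'' ((q, d') :: (p, c') :: l'')) := by
      simp only [← createAmp_smul, ← createAmp_sum]
      congr 1
      funext r j l''
      have h := R.ybe_comp p q r a b j (fun c' d' j'' => F r j'' ((q, d') :: (p, c') :: l''))
      rw [h]
      have hs : ∀ a' b' j'', F r j'' ((p, a') :: (q, b') :: l'')
          = ∑ c', ∑ d', R.mat p q (a', b') (c', d') * F r j'' ((q, d') :: (p, c') :: l'') :=
        fun a' b' j'' => hF r j'' [] l'' p q a' b'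
      simp only [hs]
    rw [h1, h2]
    ring
  | cons x l ih =>
    obtain ⟨k, i⟩ := x
    intro F hF
    simp only [List.cons_append, createAmp, mul_add, Finset.sum_add_distrib]
    rw [hF k i, ih]
    intro r j
    have : (fun l' => ∑ i', ∑ j', R.mat k r (i, j) (i', j') * F r j' ((k, i') :: l'))
        = ∑ i', ∑ j', R.mat k r (i, j) (i', j') • (annihEnd R k i' ⟨F r j', hF r j'⟩).1 := by
      funext l''
      simp [annihEnd, Finset.sum_apply]
    rw [this]
    exact Submodule.sum_mem _ fun i' _ => Submodule.sum_mem _ fun j' _ =>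
      Submodule.smul_mem _ _ (annihEnd R k i' ⟨F r j', hF r j'⟩).2

/-- The vector `∫ dk ∑_i a†_i(k) F_i(k)`, for a vector valued function `F`. -/
def create {N : ℕ} (R : RMatrix N) (F : ℝ → Fin N → Fock R) : Fock R :=
  ⟨fun l => createAmp R l (fun k i => (F k i).1),
    fun l l' p q a b => createAmp_exchange R l' p q a b l _ fun r j => (F r j).2⟩

/-- The operator `∫ dk ∑_i a†_i(k) X_i(k)`, for an operator valued function `X`. -/
def smearEnd {N : ℕ} (R : RMatrix N) (X : ℝ → Fin N → Module.End ℂ (Fock R)) :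
    Module.End ℂ (Fock R) where
  toFun φ := create R (fun k i => X k i φ)
  map_add' φ ψ := by
    apply Subtype.ext
    funext l
    have h := createAmp_add R l (fun k i => (X k i φ).1) (fun k i => (X k i ψ).1)
    simp only [create, map_add, Submodule.coe_add, Pi.add_apply]
    exact h
  map_smul' c φ := by
    apply Subtype.ext
    funext l
    have h := createAmp_smul R l c (fun k i => (X k i φ).1)
    simp only [create, map_smul, Submodule.coe_smul, Pi.smul_apply, RingHom.id_apply, smul_eq_mul]
    exact h

/-! ### The ZF algebra -/

/-- The operators on the Fock space which are generated by the `a_i(k)` and `a†_i(k)`: polynomials,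
integrals `∫ dk ∑_i a†_i(k) X_i(k)`, and limits of sequences each of whose amplitudes is eventually
constant (such as the partial sums of a normal ordered series). -/
inductive MemZF {N : ℕ} (R : RMatrix N) : Module.End ℂ (Fock R) → Prop
  | scalar (c : ℂ) : MemZF R (algebraMap ℂ _ c)
  | annih (k : ℝ) (i : Fin N) : MemZF R (annihEnd R k i)
  | integral (X : ℝ → Fin N → Module.End ℂ (Fock R)) :
      (∀ k i, MemZF R (X k i)) → MemZF R (smearEnd R X)
  | add (X Y : Module.End ℂ (Fock R)) : MemZF R X → MemZF R Y → MemZF R (X + Y)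
  | mul (X Y : Module.End ℂ (Fock R)) : MemZF R X → MemZF R Y → MemZF R (X * Y)
  | limit (Y : ℕ → Module.End ℂ (Fock R)) (X : Module.End ℂ (Fock R)) :
      (∀ m, MemZF R (Y m)) →
      (∀ l, ∃ m₀, ∀ m, m₀ ≤ m → ∀ φ : Fock R, (Y m φ).1 l = (X φ).1 l) → MemZF R X

/-- The (completed) ZF algebra `𝓐_R`, realized faithfully on its Fock space. -/
def zfSubalgebra {N : ℕ} (R : RMatrix N) : Subalgebra ℂ (Module.End ℂ (Fock R)) where
  carrier := {X | MemZF R X}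
  mul_mem' := MemZF.mul _ _
  add_mem' := MemZF.add _ _
  algebraMap_mem' := MemZF.scalar

/-- The ZF algebra `𝓐_R`. -/
abbrev Alg {N : ℕ} (R : RMatrix N) := zfSubalgebra R

/-- The generator `a_i(k)`. -/
def ann {N : ℕ} (R : RMatrix N) (k : ℝ) (i : Fin N) : Alg R := ⟨annihEnd R k i, MemZF.annih k i⟩

/-- The element `∫ dk ∑_i a†_i(k) X_i(k)` of `𝓐_R`, for `𝓐_R`-valued functions `X_i`. -/
def intCre {N : ℕ} (R : RMatrix N) (X : ℝ → Fin N → Alg R) : Alg R :=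
  ⟨smearEnd R (fun k i => (X k i).1), MemZF.integral _ fun k i => (X k i).2⟩

/-- The generator `a†_j`, a distribution in the spectral parameter:
`cre R j f = ∫ dk f(k) a†_j(k)`. -/
def cre {N : ℕ} (R : RMatrix N) (j : Fin N) (f : ℝ → ℂ) : Alg R :=
  intCre R (fun k i => if i = j then algebraMap ℂ (Alg R) (f k) else 0)

/-! The defining exchange relations of `𝓐_R`. -/

/-- `a₁(k₁) a₂(k₂) = R₂₁(k₂,k₁) a₂(k₂) a₁(k₁)`. -/
theorem ann_mul_ann {N : ℕ} (R : RMatrix N) (k₁ k₂ : ℝ) (i j : Fin N) :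
    ann R k₁ i * ann R k₂ j
      = ∑ j', ∑ i', R.mat k₂ k₁ (j, i) (j', i') • (ann R k₂ j' * ann R k₁ i') := by
  apply Subtype.ext
  apply LinearMap.ext
  intro φ
  apply Subtype.ext
  funext l
  have := φ.2 [] l k₂ k₁ j i
  simpa [ann, annihEnd, LinearMap.sum_apply, Finset.sum_apply] using this

/-- `a₁(k₁) a†₂(k₂) = a†₂(k₂) R₁₂(k₁,k₂) a₁(k₁) + δ(k₁ - k₂) δ₁₂`, integrated over `k₂` against
`X(k₂)`. -/
theorem ann_mul_intCre {N : ℕ} (R : RMatrix N) (k : ℝ) (i : Fin N) (X : ℝ → Fin N → Alg R) :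
    ann R k i * intCre R X
      = intCre R (fun p j => ∑ i', ∑ j', R.mat k p (i, j) (i', j') • (ann R k i' * X p j'))
        + X k i := by
  apply Subtype.ext
  apply LinearMap.ext
  intro φ
  apply Subtype.ext
  funext l
  simp only [ann, annihEnd, intCre, smearEnd, create, createAmp, add_comm, MulMemClass.mk_mul_mk,
    Module.End.mul_apply, LinearMap.coe_mk, AddHom.coe_mk, AddMemClass.coe_add, LinearMap.add_apply,
    Pi.add_apply]
  congr 1
  congr 1
  funext p j l'
  simp [LinearMap.sum_apply, Finset.sum_apply]

theorem createAmp_createAmp {N : ℕ} (R : RMatrix N) (l : List (ℝ × Fin N)) :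
    ∀ F : ℝ → Fin N → ℝ → Fin N → Amp N,
      createAmp R l (fun p j l' => createAmp R l' (fun r s => F p j r s))
        = createAmp R l (fun r s l' => createAmp R l' (fun p j l'' =>
            ∑ s', ∑ j', R.mat r p (s, j) (s', j') * F p j' r s' l'')) := by
  induction l with
  | nil => intro F; simp [createAmp]
  | cons x l ih =>
    obtain ⟨q, m⟩ := x
    intro F
    simp only [createAmp, mul_add, Finset.sum_add_distrib]
    rw [createAmp_add, createAmp_add]
    simp only [← createAmp_smul, ← createAmp_sum]
    rw [ih]
    have h1 : createAmp R l (fun p j l' => ∑ i', ∑ j', R.mat q p (m, j) (i', j') *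
        ∑ s', ∑ j'', R.mat p q (j', i') (s', j'') * F q j'' p s' l') = createAmp R l (F q m) := by
      congr 1
      funext p j l'
      exact R.unit_comp q p m j (fun c' d' => F q c' p d' l')
    rw [h1]
    have h2 : (fun r s l' => createAmp R l' (fun p j l'' => ∑ s', ∑ j', R.mat r p (s, j) (s', j') *
          ∑ i', ∑ j'', R.mat q p (m, j') (i', j'') *
            ∑ i'', ∑ s'', R.mat q r (i', s') (i'', s'') * F p j'' r s'' ((q, i'') :: l'')))
        = (fun r s l' => createAmp R l' (fun p j l'' => ∑ i', ∑ s', R.mat q r (m, s) (i', s') *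
          ∑ i'', ∑ j', R.mat q p (i', j) (i'', j') *
            ∑ s'', ∑ j'', R.mat r p (s', j') (s'', j'') * F p j'' r s'' ((q, i'') :: l''))) := by
      funext r s l'
      congr 1
      funext p j l''
      have h := R.ybe_comp q r p m s j (fun a b c => F p c r b ((q, a) :: l''))
      exact h.symm
    rw [h2]
    ring

/-- `a†₁(k₁) a†₂(k₂) = a†₂(k₂) a†₁(k₁) R₂₁(k₂,k₁)`, integrated over `k₁, k₂` against
`X(k₁, k₂)`. -/
theorem intCre_intCre {N : ℕ} (R : RMatrix N) (X : ℝ → ℝ → Fin N → Fin N → Alg R) :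
    intCre R (fun k₁ i => intCre R (fun k₂ j => X k₁ k₂ i j))
      = intCre R (fun k₂ j' => intCre R (fun k₁ i' =>
          ∑ j, ∑ i, R.mat k₂ k₁ (j', i') (j, i) • X k₁ k₂ i j)) := by
  apply Subtype.ext
  apply LinearMap.ext
  intro φ
  apply Subtype.ext
  funext l
  refine (createAmp_createAmp R l (fun k₁ i k₂ j => ((X k₁ k₂ i j).1 φ).1)).trans ?_
  simp only [intCre, smearEnd, create, LinearMap.coe_mk, AddHom.coe_mk]
  congr 1
  funext r s l'
  congr 1
  funext p j l''
  simp [LinearMap.sum_apply, Finset.sum_apply]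

theorem intCre_mul {N : ℕ} (R : RMatrix N) (X : ℝ → Fin N → Alg R) (Y : Alg R) :
    intCre R X * Y = intCre R (fun k i => X k i * Y) := rfl

/-- `a_i(k) Ω = 0`. -/
theorem ann_vacuum {N : ℕ} (R : RMatrix N) (k : ℝ) (i : Fin N) :
    (ann R k i).1 (vacuum R) = 0 := by
  apply Subtype.ext
  funext l
  show (if (k, i) :: l = [] then (1 : ℂ) else 0) = 0
  simp

/-! ### Vertex operators -/

/-- Families of coefficients `T^{(n)}_{01…n}(k₀, k₁, …, k_n)`: matrices on the tensor product of the
auxiliary copy `0` and of the copies `1, …, n` of `ℂ^N`. -/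
abbrev Coeff (N : ℕ) :=
  (n : ℕ) → ℝ → (Fin n → ℝ) → Matrix (Fin (n + 1) → Fin N) (Fin (n + 1) → Fin N) ℂ

/-- `a_{β₁}(k₁) ⋯ a_{β_n}(k_n)`. -/
def annProd {N : ℕ} (R : RMatrix N) {n : ℕ} (k : Fin n → ℝ) (β : Fin n → Fin N) : Alg R :=
  (List.ofFn fun p => ann R (k p) (β p)).prod

/-- `∫ dk₁ ⋯ dk_n ∑_α a†_{α_n}(k_n) ⋯ a†_{α₁}(k₁) X_α(k₁, …, k_n)`. -/
def intCreProd {N : ℕ} (R : RMatrix N) :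
    (n : ℕ) → ((Fin n → ℝ) → (Fin n → Fin N) → Alg R) → Alg R
  | 0, X => X Fin.elim0 Fin.elim0
  | n + 1, X => intCre R fun q j => intCreProd R n fun k α => X (Fin.snoc k q) (Fin.snoc α j)

/-- The entry `(i, j)` in the auxiliary copy `0` of
`∫ dk₁ ⋯ dk_n a†_{n…1} C^{(n)}_{01…n}(k₀, k₁, …, k_n) a_{1…n}`. -/
def monomial {N : ℕ} (R : RMatrix N) (C : Coeff N) (n : ℕ) (k₀ : ℝ) (i j : Fin N) : Alg R :=
  intCreProd R n fun k α =>
    ∑ β : Fin n → Fin N, C n k₀ k (Fin.cons i α) (Fin.cons j β) • annProd R k β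

theorem createAmp_congr_zero {N : ℕ} (R : RMatrix N) (m : ℕ) (l : List (ℝ × Fin N)) :
    ∀ F : ℝ → Fin N → Amp N, l.length ≤ m → (∀ k i l', l'.length < m → F k i l' = 0) →
      createAmp R l F = 0 := by
  induction l generalizing m with
  | nil => intro F _ _; rfl
  | cons x l ih =>
    obtain ⟨k, i⟩ := x
    intro F hl hF
    simp only [List.length_cons] at hl
    obtain ⟨m, rfl⟩ : ∃ m', m = m' + 1 := ⟨m - 1, by omega⟩
    simp only [createAmp]
    rw [hF k i l (by omega), ih m _ (by omega), add_zero]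
    intro p j l' hl'
    refine Finset.sum_eq_zero fun i' _ => Finset.sum_eq_zero fun j' _ => ?_
    rw [hF _ _ _ (by simpa using hl'), mul_zero]

theorem intCreProd_apply_eq_zero {N : ℕ} (R : RMatrix N) (n : ℕ) :
    ∀ (X : (Fin n → ℝ) → (Fin n → Fin N) → Alg R) (φ : Fock R) (l : List (ℝ × Fin N)),
      l.length < n → ((intCreProd R n X).1 φ).1 l = 0 := by
  induction n with
  | zero => intro X φ l hl; omega
  | succ n ih =>
    intro X φ l hl
    exact createAmp_congr_zero R n l _ (by omega) fun k i l' hl' => ih _ φ l' hl'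

/-- The monomial of degree `n` has no component with less than `n` particles, so that the sums of
such monomials are finite on each amplitude. -/
theorem monomial_apply_eq_zero {N : ℕ} (R : RMatrix N) (C : Coeff N) (n : ℕ) (k₀ : ℝ)
    (i j : Fin N) (φ : Fock R) (l : List (ℝ × Fin N)) (hl : l.length < n) :
    ((monomial R C n k₀ i j).1 φ).1 l = 0 :=
  intCreProd_apply_eq_zero R n _ φ l hl

/-- The partial sum of order `m` of
`𝕀 + ∑_{n ≥ 1} (-1)^n / (n-1)! ∫ dk₁ ⋯ dk_n a†_{n…1} C^{(n)}_{01…n} a_{1…n}`. -/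
def partialSum {N : ℕ} (R : RMatrix N) (C : Coeff N) (k₀ : ℝ) (i j : Fin N) (m : ℕ) : Alg R :=
  (if i = j then 1 else 0)
    + ∑ n ∈ Finset.Icc 1 m, ((-1 : ℂ) ^ n / ((n - 1).factorial : ℂ)) • monomial R C n k₀ i j

theorem partialSum_apply {N : ℕ} (R : RMatrix N) (C : Coeff N) (k₀ : ℝ) (i j : Fin N) (m : ℕ)
    (φ : Fock R) (l : List (ℝ × Fin N)) (hl : l.length ≤ m) :
    ((partialSum R C k₀ i j m).1 φ).1 l = ((partialSum R C k₀ i j l.length).1 φ).1 l := by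
  simp only [partialSum, AddMemClass.coe_add, LinearMap.add_apply, Pi.add_apply]
  congr 1
  simp only [AddSubmonoidClass.coe_finsetSum, LinearMap.sum_apply, Finset.sum_apply]
  symm
  apply Finset.sum_subset (Finset.Icc_subset_Icc le_rfl hl)
  intro n hn hn'
  simp only [Finset.mem_Icc, not_and, not_le] at hn hn'
  simp [monomial_apply_eq_zero R C n k₀ i j φ l (hn' hn.1)]

/-- The operator on the Fock space each of whose amplitudes is the eventually constant value of the
partial sums. -/
def vertexEnd {N : ℕ} (R : RMatrix N) (C : Coeff N) (k₀ : ℝ) (i j : Fin N) :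
    Module.End ℂ (Fock R) where
  toFun φ := ⟨fun l => ((partialSum R C k₀ i j l.length).1 φ).1 l, by
    intro l l' p q a b
    have h := ((partialSum R C k₀ i j (l ++ (p, a) :: (q, b) :: l').length).1 φ).2 l l' p q a b
    simpa using h⟩
  map_add' φ ψ := by
    apply Subtype.ext
    funext l
    simp
  map_smul' c φ := by
    apply Subtype.ext
    funext l
    simp

/-- The vertex operator
`𝕀 + ∑_{n ≥ 1} (-1)^n / (n-1)! ∫ dk₁ ⋯ dk_n a†_{n…1} C^{(n)}_{01…n}(k₀, k₁, …, k_n) a_{1…n}`,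
an `N × N` matrix with entries in `𝓐_R`. -/
def vertexOp {N : ℕ} (R : RMatrix N) (C : Coeff N) (k₀ : ℝ) : Matrix (Fin N) (Fin N) (Alg R) :=
  fun i j => ⟨vertexEnd R C k₀ i j,
    MemZF.limit (fun m => (partialSum R C k₀ i j m).1) _ (fun m => (partialSum R C k₀ i j m).2)
      fun l => ⟨l.length, fun m hm φ => partialSum_apply R C k₀ i j m φ l hm⟩⟩

/-- The coefficients
`T^{(n)}_{01…n} = (1/n) ∑_{m=0}^n (-1)^m (n choose m)
  R_{0,n}(k₀,k_n) R_{0,n-1}(k₀,k_{n-1}) ⋯ R_{0,n-m+1}(k₀,k_{n-m+1})`. -/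
def coeffT {N : ℕ} (R : RMatrix N) : Coeff N := fun n k₀ k =>
  (n : ℂ)⁻¹ • ∑ m ∈ Finset.range (n + 1), ((-1 : ℂ) ^ m * (n.choose m : ℂ)) •
    (((List.finRange n).reverse.take m).map fun p => leg (R.mat k₀ (k p)) 0 p.succ).prod

/-- The coefficients `T^{(n)†}_{01…n}`, the adjoint operation reversing the products and being
determined by `R₁₂(k₁,k₂)† = R₂₁(k₂,k₁)`. -/
def coeffTDagger {N : ℕ} (R : RMatrix N) : Coeff N := fun n k₀ k =>
  (n : ℂ)⁻¹ • ∑ m ∈ Finset.range (n + 1), ((-1 : ℂ) ^ m * (n.choose m : ℂ)) •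
    (((List.finRange n).reverse.take m).reverse.map fun p => leg (R.mat (k p) k₀) p.succ 0).prod

/-- The vertex operator `T(k₀)`. -/
def vertexT {N : ℕ} (R : RMatrix N) : ℝ → Matrix (Fin N) (Fin N) (Alg R) :=
  vertexOp R (coeffT R)

/-- The image `T†(k₀)` of `T(k₀)` under the adjoint operation `a(k) ↔ a†(k)`, which turns
`a†_{n…1} T^{(n)} a_{1…n}` into `a†_{n…1} T^{(n)†} a_{1…n}`. -/
def vertexTDagger {N : ℕ} (R : RMatrix N) : ℝ → Matrix (Fin N) (Fin N) (Alg R) :=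
  vertexOp R (coeffTDagger R)

/-- Well-bred operators in `𝓐_R`:
`L₁(k₁) a₂(k₂) = R₂₁(k₂,k₁) a₂(k₂) L₁(k₁)` and
`L₁(k₁) a†₂(k₂) = a†₂(k₂) R₁₂(k₁,k₂) L₁(k₁)`,
where the second relation is integrated over `k₂` against an arbitrary function `f(k₂)`. -/
def WellBred {N : ℕ} (R : RMatrix N) (L : ℝ → Matrix (Fin N) (Fin N) (Alg R)) : Prop :=
  (∀ (k₁ k₂ : ℝ) (i i' j : Fin N),
    L k₁ i i' * ann R k₂ j
      = ∑ j'', ∑ i'', R.mat k₂ k₁ (j, i) (j'', i'') • (ann R k₂ j'' * L k₁ i'' i')) ∧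
  (∀ (k₁ : ℝ) (f : ℝ → ℂ) (i i' j : Fin N),
    L k₁ i i' * cre R j f
      = ∑ i'', ∑ j'', cre R j'' (fun k₂ => f k₂ * R.mat k₁ k₂ (i, j'') (i'', j)) * L k₁ i'' i')

/-- `R₁₂(k₁,k₂) T₁(k₁) T₂(k₂)` for a matrix `T(k)` with entries in an algebra, where `T₁ = T ⊗ 𝕀`
and `T₂ = 𝕀 ⊗ T`. -/
def rttLeft {N : ℕ} (R : RMatrix N) {A : Type} [Semiring A] [Algebra ℂ A]
    (T : ℝ → Matrix (Fin N) (Fin N) A) (k₁ k₂ : ℝ) : Matrix (Fin N × Fin N) (Fin N × Fin N) A :=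
  (R.mat k₁ k₂).map (algebraMap ℂ A) * (T k₁ ⊗ₖ 1) * (1 ⊗ₖ T k₂)

/-- `T₂(k₂) T₁(k₁) R₁₂(k₁,k₂)`. -/
def rttRight {N : ℕ} (R : RMatrix N) {A : Type} [Semiring A] [Algebra ℂ A]
    (T : ℝ → Matrix (Fin N) (Fin N) A) (k₁ k₂ : ℝ) : Matrix (Fin N × Fin N) (Fin N × Fin N) A :=
  (1 ⊗ₖ T k₂) * (T k₁ ⊗ₖ 1) * (R.mat k₁ k₂).map (algebraMap ℂ A)

/-- The matrix of generators of the free algebra on symbols `T_{ij}(k)`. -/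
def freeT (N : ℕ) (k : ℝ) : Matrix (Fin N) (Fin N) (FreeAlgebra ℂ (ℝ × Fin N × Fin N)) :=
  fun i j => FreeAlgebra.ι ℂ (k, i, j)

/-- The defining relations of `𝓤_R`: the entries of the two sides of the `RTT` relation. -/
inductive URRel {N : ℕ} (R : RMatrix N) :
    FreeAlgebra ℂ (ℝ × Fin N × Fin N) → FreeAlgebra ℂ (ℝ × Fin N × Fin N) → Prop
  | rtt (k₁ k₂ : ℝ) (x y : Fin N × Fin N) :
      URRel R (rttLeft R (freeT N) k₁ k₂ x y) (rttRight R (freeT N) k₁ k₂ x y)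

/-- The quantum group `𝓤_R`, as the algebra generated by the entries of the matrices `T(k)` subject
to the `RTT` relation. -/
abbrev UR {N : ℕ} (R : RMatrix N) := RingQuot (URRel R)

/-- The generator `T_{ij}(k)` of `𝓤_R`. -/
def UR.gen {N : ℕ} (R : RMatrix N) (k : ℝ) (i j : Fin N) : UR R :=
  RingQuot.mkAlgHom ℂ (URRel R) (freeT N k i j)

/-! ### Adjoints on the Fock space -/

/-- The amplitude of the `n`-particle component at `(k₁, α₁), …, (k_n, α_n)`. -/
def sector {N : ℕ} {R : RMatrix N} (φ : Fock R) (n : ℕ) (k : Fin n → ℝ) (α : Fin n → Fin N) : ℂ :=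
  φ.1 (List.ofFn fun p => (k p, α p))

/-- Finitely many particles, with measurable and square integrable amplitudes. -/
def IsRegular {N : ℕ} {R : RMatrix N} (φ : Fock R) : Prop :=
  (∃ n₀, ∀ l, n₀ < l.length → φ.1 l = 0) ∧
    ∀ (n : ℕ) (α : Fin n → Fin N),
      MeasureTheory.MemLp (fun k => sector φ n k α) 2 MeasureTheory.volume

/-- The scalar product of the Fock space. -/
def fockInner {N : ℕ} {R : RMatrix N} (φ ψ : Fock R) : ℂ :=
  ∑' n : ℕ, ((n.factorial : ℂ)⁻¹ *
    ∫ k : Fin n → ℝ, ∑ α : Fin n → Fin N, conj (sector φ n k α) * sector ψ n k α)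

/-- `Y` is an adjoint of `X` with respect to the scalar product. -/
def IsAdjointOf {N : ℕ} {R : RMatrix N} (Y X : Alg R) : Prop :=
  ∀ φ ψ : Fock R, IsRegular φ → IsRegular ψ → fockInner φ (X.1 ψ) = fockInner (Y.1 φ) ψ

end ZF

end

/-!
The operator `T(k₀)` is diagonal in the particle number and in the spectral parameters: on the
amplitude at `(k₁, i₁), …, (k_M, i_M)` it acts as multiplication by the finite product
`R₀₁(k₀,k₁) R₀₂(k₀,k₂) ⋯ R₀M(k₀,k_M)`, the *transfer operator* `transferAmp`. Likewise `T†(k₀)` acts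
as multiplication by `R_{M0}(k_M,k₀) ⋯ R₁₀(k₁,k₀)`. All the assertions follow from this description
by induction on the list of particles: stability of the Fock space, the exchange with creation
operators and the `RTT` relation from the Yang-Baxter equation, the exchange with annihilation
operators, uniqueness and `T T† = T† T = 𝕀` from unitarity, and adjointness holds already pointwise
in the spectral parameters, before any integration.

The identification of the series with the transfer operator is `vertexOp_apply_eq_transferAmp`.
Writing `n = p + m`, and absorbing the unit as the term `n = 0`, the series is
`T(k₀) = ∑_{p,m} (-1)^p / (p! m!) ∫ a†_{n…1} R₀ₙ ⋯ R₀,ₚ₊₁ a_{1…n}`.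
The matrices do not act on the copies `1, …, p`, and for fixed `m` the sum over `p` replaces the
innermost part by `∑_p (-1)^p / p! ∫ a†_{p…1} a_{1…p}`, which is the projector on the vacuum because
`∫ a†_{p…1} a_{1…p}` is a falling factorial of the particle number
(`chainMonomial_length_zero_apply`, `sum_descFactorial`). What remains is
`1/m! ∫ a†_{m…1} R₀ₘ ⋯ R₀₁ Π_Ω a_{1…m}`. It vanishes outside the sector of `m` particles, and there
it is multiplication by the product of the `R₀ᵣ`, since a vector of that sector with amplitudes
`ψ` is recovered from `1/m! ∫ a†_{m…1} ψ Ω` (`createAmp_number`, `sum_chainMonomial_apply`).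
-/

open scoped Matrix Kronecker ComplexConjugate

noncomputable section

namespace ZF

/-! ### Transfer operators -/

/-- The amplitude at `(k₁, c₁), …, (k_n, c_n)` of the vector with auxiliary index `a` obtained by
letting the product `K₀₁(k₁) ⋯ K₀ₙ(k_n)` act on `v ⊗ φ`, where `v` lives in the auxiliary copy. It
is encoded by recursion on the list of particles, the first of which is acted upon by the leftmost
factor. -/
def transferAmp {N : ℕ} (K : ℝ → TwoBody N) (v : Fin N → ℂ) :
    List (ℝ × Fin N) → Fin N → Amp N → ℂ
  | [], a, φ => v a * φ []
  | (k, c) :: l, a, φ =>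
      ∑ a', ∑ c', K k (a, c) (a', c') * transferAmp K v l a' (fun l' => φ ((k, c') :: l'))

theorem sum_comm_pair {ι κ : Type} [Fintype ι] [Fintype κ] (f : ι → ι → κ → κ → ℂ) :
    ∑ a, ∑ b, ∑ c, ∑ d, f a b c d = ∑ c, ∑ d, ∑ a, ∑ b, f a b c d := by
  have h : ∑ x : ι × ι, ∑ y : κ × κ, f x.1 x.2 y.1 y.2
      = ∑ y : κ × κ, ∑ x : ι × ι, f x.1 x.2 y.1 y.2 := Finset.sum_comm
  simpa only [Fintype.sum_prod_type] using h

theorem transferAmp_add {N : ℕ} (K : ℝ → TwoBody N) (v : Fin N → ℂ) (l : List (ℝ × Fin N)) :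
    ∀ (a : Fin N) (φ ψ : Amp N), transferAmp K v l a (fun l' => φ l' + ψ l')
      = transferAmp K v l a φ + transferAmp K v l a ψ := by
  induction l with
  | nil => intro a φ ψ; simp [transferAmp, mul_add]
  | cons x l ih =>
    obtain ⟨k, c⟩ := x
    intro a φ ψ
    simp only [transferAmp]
    simp only [ih, mul_add, Finset.sum_add_distrib]

theorem transferAmp_smul {N : ℕ} (K : ℝ → TwoBody N) (v : Fin N → ℂ) (l : List (ℝ × Fin N)) :
    ∀ (a : Fin N) (z : ℂ) (φ : Amp N), transferAmp K v l a (fun l' => z * φ l')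
      = z * transferAmp K v l a φ := by
  induction l with
  | nil => intro a z φ; simp only [transferAmp]; ring
  | cons x l ih =>
    obtain ⟨k, c⟩ := x
    intro a z φ
    simp only [transferAmp]
    simp only [ih, mul_left_comm _ z, ← Finset.mul_sum]

theorem transferAmp_sum {N : ℕ} (K : ℝ → TwoBody N) (v : Fin N → ℂ) (l : List (ℝ × Fin N))
    (a : Fin N) {ι : Type} (s : Finset ι) (φ : ι → Amp N) :
    transferAmp K v l a (fun l' => ∑ x ∈ s, φ x l') = ∑ x ∈ s, transferAmp K v l a (φ x) := by
  classical
  induction s using Finset.induction_on with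
  | empty =>
    simp only [Finset.sum_empty]
    simpa using transferAmp_smul K v l a 0 (fun _ => 0)
  | insert x s hx ih =>
    simp only [Finset.sum_insert hx]
    rw [transferAmp_add, ih]

/-- The relation `K₀₁(p) K₀₂(q) R₁₂(p,q) = R₁₂(p,q) K₀₂(q) K₀₁(p)`, applied to a vector `w`. -/
def Intertwines {N : ℕ} (R : RMatrix N) (K : ℝ → TwoBody N) : Prop :=
  ∀ (p q : ℝ) (a b c : Fin N) (w : Fin N → Fin N → Fin N → ℂ),
    ∑ a', ∑ b', K p (a, b) (a', b') * ∑ a'', ∑ c', K q (a', c) (a'', c')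
        * ∑ d, ∑ e, R.mat p q (b', c') (d, e) * w a'' d e
      = ∑ d, ∑ e, R.mat p q (b, c) (d, e) * ∑ a', ∑ e', K q (a, e) (a', e')
        * ∑ a'', ∑ d', K p (a', d) (a'', d') * w a'' d' e'

theorem intertwines_mat {N : ℕ} (R : RMatrix N) (k₀ : ℝ) : Intertwines R (R.mat k₀) :=
  fun p q a b c w => R.ybe_comp k₀ p q a b c w

/-- The matrix `R_{10}(k₁,k₀)`, transposed in the auxiliary copy `0`. The transposition lets the
products `R_{n0} ⋯ R_{10}` be read from left to right. -/
def daggerMat {N : ℕ} (R : RMatrix N) (k₀ k : ℝ) : TwoBody N :=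
  fun x y => R.mat k k₀ (x.2, y.1) (y.2, x.1)

theorem intertwines_daggerMat {N : ℕ} (R : RMatrix N) (k₀ : ℝ) :
    Intertwines R (daggerMat R k₀) := by
  intro p q a b c w
  have h := fun t => R.ybe_comp p q k₀ b c t (fun x y z => if z = a then w t x y else 0)
  simp only [mul_ite, mul_zero, Finset.sum_ite_eq', Finset.mem_univ, if_true,
    Finset.sum_ite_irrel, Finset.sum_const_zero] at h
  have h' := Finset.sum_congr rfl fun t (_ : t ∈ Finset.univ) => h t
  simp only [daggerMat, Finset.mul_sum] at h' ⊢
  simp only [← Fintype.sum_prod_type'] at h' ⊢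
  -- Both sides of `h'` are the two sides of the goal, up to renaming of the summation indices.
  refine Eq.trans ?_ (h'.symm.trans ?_)
  · refine Fintype.sum_equiv ⟨fun x => (x.2.2.1, x.2.2.2.1, x.1, x.2.1, x.2.2.2.2),
      fun y => (y.2.2.1, y.2.2.2.1, y.1, y.2.1, y.2.2.2.2), fun _ => rfl, fun _ => rfl⟩ _ _
      fun x => ?_
    simp only [Equiv.coe_fn_mk]
    ring
  · refine Fintype.sum_equiv
      ⟨fun y => (y.2.1, y.2.2.1, y.2.2.2.2.1, y.2.2.2.2.2, y.1, y.2.2.2.1),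
      fun z => (z.2.2.2.2.1, z.1, z.2.1, z.2.2.2.2.2, z.2.2.1, z.2.2.2.1),
      fun _ => rfl, fun _ => rfl⟩ _ _ fun x => ?_
    simp only [Equiv.coe_fn_mk]
    ring

theorem transferAmp_exchange {N : ℕ} (R : RMatrix N) {K : ℝ → TwoBody N} (hK : Intertwines R K)
    (v : Fin N → ℂ) (l' : List (ℝ × Fin N)) (p q : ℝ) (b c : Fin N) (l : List (ℝ × Fin N)) :
    ∀ (a : Fin N) (φ : Amp N), φ ∈ Fock R →
      transferAmp K v (l ++ (p, b) :: (q, c) :: l') a φ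
        = ∑ d, ∑ e, R.mat p q (b, c) (d, e)
            * transferAmp K v (l ++ (q, e) :: (p, d) :: l') a φ := by
  induction l with
  | nil =>
    intro a φ hφ
    have hs : ∀ b' c', (fun l'' => φ ((p, b') :: (q, c') :: l''))
        = fun l'' => ∑ d, ∑ e, R.mat p q (b', c') (d, e) * φ ((q, e) :: (p, d) :: l'') :=
      fun b' c' => funext fun l'' => hφ [] l'' p q b' c'
    simp only [List.nil_append, transferAmp]
    simp only [hs, transferAmp_sum, transferAmp_smul]
    exact hK p q a b c fun a'' d e => transferAmp K v l' a'' fun l'' => φ ((q, e) :: (p, d) :: l'')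
  | cons x l ih =>
    obtain ⟨k, i⟩ := x
    intro a φ hφ
    simp only [List.cons_append, transferAmp, Finset.mul_sum]
    have h := fun c' a' => ih a' (fun l' => φ ((k, c') :: l')) (annihEnd R k c' ⟨φ, hφ⟩).2
    simp only [h, Finset.mul_sum]
    rw [sum_comm_pair]
    simp only [mul_left_comm]

theorem transferAmp_mem_fock {N : ℕ} (R : RMatrix N) {K : ℝ → TwoBody N} (hK : Intertwines R K)
    (v : Fin N → ℂ) (a : Fin N) (φ : Fock R) : (fun l => transferAmp K v l a φ.1) ∈ Fock R :=
  fun l l' p q b c => transferAmp_exchange R hK v l' p q b c l a φ.1 φ.2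

/-- Transfer operators with `K₀₁(k) = R₀₁(k₀,k)` pass through creation operators by means of an
`R`-matrix. -/
theorem transferAmp_createAmp {N : ℕ} (R : RMatrix N) (k₀ : ℝ) (v : Fin N → ℂ)
    (l : List (ℝ × Fin N)) :
    ∀ (i : Fin N) (F : ℝ → Fin N → Amp N),
      transferAmp (R.mat k₀) v l i (fun l' => createAmp R l' F)
        = createAmp R l (fun p j l' => ∑ i', ∑ j', R.mat k₀ p (i, j) (i', j')
            * transferAmp (R.mat k₀) v l' i' (F p j')) := by
  induction l with
  | nil => intro i F; simp [transferAmp, createAmp]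
  | cons x l ih =>
    obtain ⟨k, c⟩ := x
    intro i F
    simp only [transferAmp, createAmp]
    simp only [transferAmp_add, ih, mul_add, Finset.sum_add_distrib]
    congr 1
    simp only [← createAmp_smul, ← createAmp_sum, transferAmp_sum, transferAmp_smul]
    congr 1
    funext p j l'
    exact R.ybe_comp k₀ k p i c j
      (fun a b d => transferAmp (R.mat k₀) v l' a (fun l'' => F p d ((k, b) :: l'')))

/-! ### Creation and particle number -/

theorem createAmp_congr_length {N : ℕ} (R : RMatrix N) (l : List (ℝ × Fin N)) :
    ∀ F G : ℝ → Fin N → Amp N, (∀ k i l', l'.length + 1 = l.length → F k i l' = G k i l') →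
      createAmp R l F = createAmp R l G := by
  induction l with
  | nil => intro F G _; rfl
  | cons x l ih =>
    obtain ⟨k, i⟩ := x
    intro F G h
    simp only [createAmp]
    rw [h k i l (by simp)]
    congr 1
    refine ih _ _ fun p j l' hl' => ?_
    simp only [h p _ ((k, _) :: l') (by simp [hl'])]

/-- `∫ dk ∑_i a†_i(k) a_i(k)` is the particle number operator; the weight `g` stands for a function
of the particle number inserted between `a†` and `a`. -/
theorem createAmp_number {N : ℕ} (R : RMatrix N) (l : List (ℝ × Fin N)) :
    ∀ (g : ℕ → ℂ) (φ : Amp N), φ ∈ Fock R →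
      createAmp R l (fun k i l' => g l'.length * φ ((k, i) :: l'))
        = l.length * g (l.length - 1) * φ l := by
  induction l with
  | nil => intro g φ _; simp [createAmp]
  | cons x l ih =>
    obtain ⟨k, i⟩ := x
    intro g φ hφ
    have h : (fun p j l' => ∑ i', ∑ j', R.mat k p (i, j) (i', j') *
          (g ((k, i') :: l').length * φ ((p, j') :: (k, i') :: l')))
        = fun p j l' => g (l'.length + 1) * (annihEnd R k i ⟨φ, hφ⟩).1 ((p, j) :: l') := by
      funext p j l'
      simp only [List.length_cons, mul_left_comm _ (g _), ← Finset.mul_sum]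
      congr 1
      exact (hφ [] l' k p i j).symm
    simp only [createAmp]
    rw [h, ih (fun n => g (n + 1)) _ (annihEnd R k i ⟨φ, hφ⟩).2]
    simp only [List.length_cons, Nat.add_sub_cancel, Nat.cast_add, Nat.cast_one, annihEnd,
      LinearMap.coe_mk, AddHom.coe_mk]
    rcases Nat.eq_zero_or_pos l.length with h0 | h0
    · simp [h0]
    · rw [Nat.sub_add_cancel h0]; ring

/-! ### Linearity of normal ordered monomials -/

theorem intCre_sum {N : ℕ} (R : RMatrix N) {ι : Type} (s : Finset ι)
    (X : ι → ℝ → Fin N → Alg R) :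
    intCre R (fun k i => ∑ x ∈ s, X x k i) = ∑ x ∈ s, intCre R (X x) := by
  apply Subtype.ext
  apply LinearMap.ext
  intro φ
  apply Subtype.ext
  funext l
  have h := createAmp_sum R l s (fun x k i => ((X x k i).1 φ).1)
  simp only [AddSubmonoidClass.coe_finsetSum, LinearMap.sum_apply, Finset.sum_apply]
  refine Eq.trans ?_ h
  simp only [intCre, smearEnd, create, LinearMap.coe_mk, AddHom.coe_mk]
  congr 1
  funext k i l'
  simp [LinearMap.sum_apply, Finset.sum_apply]

theorem intCre_smul {N : ℕ} (R : RMatrix N) (z : ℂ) (X : ℝ → Fin N → Alg R) :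
    intCre R (fun k i => z • X k i) = z • intCre R X := by
  apply Subtype.ext
  apply LinearMap.ext
  intro φ
  apply Subtype.ext
  funext l
  exact createAmp_smul R l z (fun k i => ((X k i).1 φ).1)

theorem intCreProd_sum {N : ℕ} (R : RMatrix N) {ι : Type} (s : Finset ι) (n : ℕ) :
    ∀ X : ι → (Fin n → ℝ) → (Fin n → Fin N) → Alg R,
      intCreProd R n (fun k α => ∑ x ∈ s, X x k α) = ∑ x ∈ s, intCreProd R n (X x) := by
  induction n with
  | zero => intro X; rfl
  | succ n ih =>
    intro X
    simp only [intCreProd]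
    simp only [ih, intCre_sum]

theorem intCreProd_smul {N : ℕ} (R : RMatrix N) (z : ℂ) (n : ℕ) :
    ∀ X : (Fin n → ℝ) → (Fin n → Fin N) → Alg R,
      intCreProd R n (fun k α => z • X k α) = z • intCreProd R n X := by
  induction n with
  | zero => intro X; rfl
  | succ n ih =>
    intro X
    simp only [intCreProd]
    simp only [ih, intCre_smul]

theorem intCreProd_mul {N : ℕ} (R : RMatrix N) (Y : Alg R) (n : ℕ) :
    ∀ X : (Fin n → ℝ) → (Fin n → Fin N) → Alg R,
      intCreProd R n X * Y = intCreProd R n (fun k α => X k α * Y) := by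
  induction n with
  | zero => intro X; rfl
  | succ n ih =>
    intro X
    simp only [intCreProd]
    simp only [intCre_mul, ih]

theorem annProd_snoc {N : ℕ} (R : RMatrix N) {n : ℕ} (k : Fin n → ℝ) (q : ℝ)
    (β : Fin n → Fin N) (y : Fin N) :
    annProd R (Fin.snoc k q : Fin (n + 1) → ℝ) (Fin.snoc β y : Fin (n + 1) → Fin N)
      = annProd R k β * ann R q y := by
  rw [annProd, List.ofFn_succ_last]
  simp [annProd]

/-! ### Coefficients which are products of two-body matrices -/

/-- The matrix element of `K₀ₙ(kₙ) K₀,ₙ₋₁(kₙ₋₁) ⋯ K₀,ₙ₋ₘ₊₁(kₙ₋ₘ₊₁)` between `(a, α)` and `(v, β)`,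
where `v` is a vector in the auxiliary copy, by recursion on the number of copies. -/
def legChain {N : ℕ} (K : ℝ → TwoBody N) (v : Fin N → ℂ) :
    (n m : ℕ) → Fin N → (Fin n → ℝ) → (Fin n → Fin N) → (Fin n → Fin N) → ℂ
  | 0, _, a, _, _, _ => v a
  | n + 1, 0, a, k, α, β =>
      if α (Fin.last n) = β (Fin.last n) then
        legChain K v n 0 a (Fin.init k) (Fin.init α) (Fin.init β) else 0
  | n + 1, m + 1, a, k, α, β =>
      ∑ a', K (k (Fin.last n)) (a, α (Fin.last n)) (a', β (Fin.last n))
        * legChain K v n m a' (Fin.init k) (Fin.init α) (Fin.init β)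

/-- Partial transposition in the copies `1, …, n`. -/
theorem legChain_swap {N : ℕ} (K : ℝ → TwoBody N) (v : Fin N → ℂ) (n : ℕ) :
    ∀ (m : ℕ) (a : Fin N) (k : Fin n → ℝ) (α β : Fin n → Fin N),
      legChain (fun q x y => K q (x.1, y.2) (y.1, x.2)) v n m a k α β
        = legChain K v n m a k β α := by
  induction n with
  | zero => intro m a k α β; rfl
  | succ n ih =>
    intro m a k α β
    cases m with
    | zero => simp only [legChain, ih, eq_comm]
    | succ m => simp only [legChain, ih]

/-- The monomial `∫ dk₁ ⋯ dkₙ a†_{n…1} K₀ₙ ⋯ K₀,ₙ₋ₘ₊₁ v a_{1…n}`. -/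
def chainMonomial {N : ℕ} (R : RMatrix N) (K : ℝ → TwoBody N) (v : Fin N → ℂ) (n m : ℕ)
    (a : Fin N) : Alg R :=
  intCreProd R n fun k α => ∑ β : Fin n → Fin N, legChain K v n m a k α β • annProd R k β

theorem sum_snoc {N n : ℕ} {A : Type} [AddCommMonoid A] (f : (Fin (n + 1) → Fin N) → A) :
    ∑ β, f β = ∑ y : Fin N, ∑ β : Fin n → Fin N, f (Fin.snoc β y) := by
  rw [← Fintype.sum_prod_type']
  exact (Fintype.sum_equiv (Fin.snocEquiv fun _ => Fin N) _ _ fun _ => rfl).symm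

theorem chainMonomial_zero {N : ℕ} (R : RMatrix N) (K : ℝ → TwoBody N) (v : Fin N → ℂ) (m : ℕ)
    (a : Fin N) : chainMonomial R K v 0 m a = algebraMap ℂ (Alg R) (v a) := by
  simp [chainMonomial, intCreProd, legChain, annProd, Algebra.algebraMap_eq_smul_one]

theorem chainMonomial_succ_zero {N : ℕ} (R : RMatrix N) (K : ℝ → TwoBody N) (v : Fin N → ℂ)
    (n : ℕ) (a : Fin N) :
    chainMonomial R K v (n + 1) 0 a
      = intCre R fun q x => chainMonomial R K v n 0 a * ann R q x := by
  simp only [chainMonomial, intCreProd, intCreProd_mul]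
  congr 1
  funext q x
  congr 1
  funext k α
  rw [sum_snoc]
  simp [legChain, annProd_snoc, Finset.sum_mul, Finset.sum_ite_irrel]

theorem chainMonomial_succ_succ {N : ℕ} (R : RMatrix N) (K : ℝ → TwoBody N) (v : Fin N → ℂ)
    (n m : ℕ) (a : Fin N) :
    chainMonomial R K v (n + 1) (m + 1) a
      = intCre R fun q x => ∑ a', ∑ y, K q (a, x) (a', y)
          • (chainMonomial R K v n m a' * ann R q y) := by
  simp only [chainMonomial, intCreProd, intCreProd_mul, ← intCreProd_smul, ← intCreProd_sum]
  congr 1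
  funext q x
  congr 1
  funext k α
  rw [sum_snoc]
  simp only [legChain, annProd_snoc, Finset.sum_mul, Finset.sum_smul, Finset.smul_sum,
    Fin.snoc_last, Fin.init_snoc, smul_mul_assoc, smul_smul]
  conv_rhs => rw [Finset.sum_comm]
  refine Finset.sum_congr rfl fun y _ => ?_
  rw [Finset.sum_comm]

theorem intCre_apply {N : ℕ} (R : RMatrix N) (X : ℝ → Fin N → Alg R) (φ : Fock R)
    (l : List (ℝ × Fin N)) :
    ((intCre R X).1 φ).1 l = createAmp R l (fun k i => ((X k i).1 φ).1) := rfl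

theorem ann_apply {N : ℕ} (R : RMatrix N) (k : ℝ) (i : Fin N) (φ : Fock R)
    (l : List (ℝ × Fin N)) : ((ann R k i).1 φ).1 l = φ.1 ((k, i) :: l) := rfl

/-- Falling factorial of the particle number operator. -/
theorem chainMonomial_length_zero_apply {N : ℕ} (R : RMatrix N) (K : ℝ → TwoBody N)
    (v : Fin N → ℂ) (a : Fin N) (n : ℕ) :
    ∀ (φ : Fock R) (l : List (ℝ × Fin N)),
      ((chainMonomial R K v n 0 a).1 φ).1 l = l.length.descFactorial n * v a * φ.1 l := by
  induction n with
  | zero =>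
    intro φ l
    simp [chainMonomial_zero, Algebra.algebraMap_eq_smul_one]
  | succ n ih =>
    intro φ l
    rw [chainMonomial_succ_zero, intCre_apply]
    have h : (fun k i => ((chainMonomial R K v n 0 a * ann R k i).1 φ).1)
        = fun k i l' => (l'.length.descFactorial n * v a) * φ.1 ((k, i) :: l') := by
      funext k i l'
      exact ih ((ann R k i).1 φ) l'
    rw [h, createAmp_number R l (fun t => t.descFactorial n * v a) φ.1 φ.2]
    rcases Nat.eq_zero_or_pos l.length with h0 | h0
    · simp [h0]
    · obtain ⟨t, ht⟩ : ∃ t, l.length = t + 1 := ⟨l.length - 1, by omega⟩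
      rw [ht, Nat.succ_descFactorial_succ]
      push_cast
      ring

/-- The binomial theorem at `1 - 1`, as a statement on falling factorials. -/
theorem sum_descFactorial (M P : ℕ) (h : M < P) :
    ∑ p ∈ Finset.range P, (-1 : ℂ) ^ p / (p.factorial : ℂ) * (M.descFactorial p : ℂ)
      = if M = 0 then 1 else 0 := by
  have h1 : ∀ p, (-1 : ℂ) ^ p / (p.factorial : ℂ) * (M.descFactorial p : ℂ)
      = (((-1) ^ p * (M.choose p : ℤ) : ℤ) : ℂ) := by
    intro p
    have hp : (p.factorial : ℂ) ≠ 0 := by exact_mod_cast p.factorial_ne_zero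
    rw [Nat.descFactorial_eq_factorial_mul_choose]
    push_cast
    field_simp
  simp only [h1]
  rw [← Int.cast_sum, ← Finset.sum_subset (Finset.range_mono (Nat.succ_le_of_lt h)),
    Int.alternating_sum_range_choose]
  · split_ifs <;> simp
  · intro p _ hp
    rw [Nat.choose_eq_zero_of_lt (by simpa using hp)]
    simp

/-- The sum over the number `p` of copies on which the coefficient is the identity produces the
projector on the vacuum, so that only the sector of `m` particles is left. There,
`∫ dk₁ ⋯ dkₘ a†_{m…1} Π_Ω a_{1…m}` is `m!` times the identity. -/
theorem sum_chainMonomial_apply {N : ℕ} (R : RMatrix N) {K : ℝ → TwoBody N}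
    (hK : Intertwines R K) (v : Fin N → ℂ) (P m : ℕ) :
    ∀ (a : Fin N) (φ : Fock R) (l : List (ℝ × Fin N)), l.length < P + m →
      ∑ p ∈ Finset.range P, (-1 : ℂ) ^ p / (p.factorial : ℂ)
          * ((chainMonomial R K v (p + m) m a).1 φ).1 l
        = if l.length = m then (m.factorial : ℂ) * transferAmp K v l a φ.1 else 0 := by
  induction m with
  | zero =>
    intro a φ l hl
    simp only [Nat.add_zero, chainMonomial_length_zero_apply, ← mul_assoc, ← Finset.sum_mul]
    rw [sum_descFactorial l.length P hl]
    rcases l with _ | ⟨x, l⟩ <;> simp [transferAmp]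
  | succ m ih =>
    intro a φ l hl
    have h1 : ∀ p, ((chainMonomial R K v (p + (m + 1)) (m + 1) a).1 φ).1 l
        = createAmp R l fun q x l' => ∑ a', ∑ y, K q (a, x) (a', y)
          * ((chainMonomial R K v (p + m) m a').1 ((ann R q y).1 φ)).1 l' := by
      intro p
      rw [← Nat.add_assoc, chainMonomial_succ_succ, intCre_apply]
      congr 1
      funext q x l'
      simp [LinearMap.sum_apply, Finset.sum_apply]
    simp only [h1, ← createAmp_smul, ← createAmp_sum]
    -- By the recursion for `transferAmp`, the factor `K` acting on the outermost copy completes the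
    -- transfer operator for `m` particles to the one for `m + 1` particles.
    have h2 : createAmp R l (fun q x l' => ∑ p ∈ Finset.range P, (-1 : ℂ) ^ p / (p.factorial : ℂ)
          * ∑ a', ∑ y, K q (a, x) (a', y)
            * ((chainMonomial R K v (p + m) m a').1 ((ann R q y).1 φ)).1 l')
        = createAmp R l (fun q x l' => (if l'.length = m then (m.factorial : ℂ) else 0)
            * transferAmp K v ((q, x) :: l') a φ.1) := by
      apply createAmp_congr_length
      intro q x l' hl'
      simp only [Finset.mul_sum, mul_left_comm _ (K _ _ _)]
      rw [Finset.sum_comm]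
      simp only [Finset.sum_comm (s := Finset.range P), ← Finset.mul_sum]
      have h3 := fun a' y => ih a' ((ann R q y).1 φ) l' (by omega)
      simp only [h3, transferAmp]
      split_ifs with h0
      · simp only [Finset.mul_sum, mul_left_comm _ (K _ _ _)]
        rfl
      · simp
    rw [h2, createAmp_number R l (fun t => if t = m then (m.factorial : ℂ) else 0)
      (fun l => transferAmp K v l a φ.1) (transferAmp_mem_fock R hK v a φ)]
    rcases Nat.eq_zero_or_pos l.length with h0 | h0
    · simp [h0]
    · obtain ⟨t, ht⟩ : ∃ t, l.length = t + 1 := ⟨l.length - 1, by omega⟩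
      simp only [ht, Nat.add_sub_cancel, Nat.add_right_cancel_iff]
      split_ifs with htm
      · subst htm
        rw [Nat.factorial_succ]
        push_cast
        ring
      · ring

/-- A vertex operator with the coefficients
`(1/n) ∑ₘ (-1)^m (n choose m) K₀ₙ(kₙ) ⋯ K₀,ₙ₋ₘ₊₁(kₙ₋ₘ₊₁)` is a transfer operator. The index `a`
and the vector `v` say how the entry `(i, j)` is obtained from the product of the `K₀ᵣ`. For `n = 0`
the hypothesis on `C` reads `C = 0`, because `0⁻¹ = 0`; the unit of the series is supplied
separately. -/
theorem vertexOp_apply_eq_transferAmp {N : ℕ} (R : RMatrix N) {K : ℝ → TwoBody N}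
    (hK : Intertwines R K) (v : Fin N → ℂ) (C : Coeff N) (k₀ : ℝ) (i j a : Fin N)
    (hv : v a = if i = j then 1 else 0)
    (hC : ∀ (n : ℕ) (k : Fin n → ℝ) (α β : Fin n → Fin N),
      C n k₀ k (Fin.cons i α) (Fin.cons j β)
        = (n : ℂ)⁻¹ * ∑ m ∈ Finset.range (n + 1), ((-1 : ℂ) ^ m * (n.choose m : ℂ))
            * legChain K v n m a k α β)
    (φ : Fock R) (l : List (ℝ × Fin N)) :
    ((vertexOp R C k₀ i j).1 φ).1 l = transferAmp K v l a φ.1 := by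
  have hmon : ∀ n, monomial R C n k₀ i j = (n : ℂ)⁻¹ • ∑ m ∈ Finset.range (n + 1),
      ((-1 : ℂ) ^ m * (n.choose m : ℂ)) • chainMonomial R K v n m a := by
    intro n
    simp only [monomial, chainMonomial, hC, ← intCreProd_smul, ← intCreProd_sum]
    congr 1
    funext k α
    simp only [Finset.smul_sum, Finset.sum_smul, Finset.mul_sum, smul_smul]
    rw [Finset.sum_comm]
  -- The amplitude of the term with `m` matrices and `p` copies without a matrix.
  set A : ℕ → ℕ → ℂ := fun m p => (-1 : ℂ) ^ p / (p.factorial : ℂ) / (m.factorial : ℂ)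
    * ((chainMonomial R K v (p + m) m a).1 φ).1 l with hA
  have hterm : ∀ n, 1 ≤ n → (-1 : ℂ) ^ n / ((n - 1).factorial : ℂ)
        * ((monomial R C n k₀ i j).1 φ).1 l
      = ∑ m ∈ Finset.range (n + 1), A m (n - m) := by
    intro n hn
    rw [hmon]
    simp only [SetLike.val_smul, AddSubmonoidClass.coe_finsetSum, LinearMap.smul_apply,
      LinearMap.sum_apply, Pi.smul_apply, Finset.sum_apply,
      smul_eq_mul, Finset.mul_sum]
    refine Finset.sum_congr rfl fun m hm => ?_
    have hm' : m ≤ n := Nat.lt_succ_iff.mp (Finset.mem_range.mp hm)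
    obtain ⟨p, rfl⟩ : ∃ p, n = p + m := ⟨n - m, by omega⟩
    obtain ⟨t, ht⟩ : ∃ t, p + m = t + 1 := ⟨p + m - 1, by omega⟩
    simp only [hA, Nat.add_sub_cancel]
    have hf : ((p + m).factorial : ℂ) = ((p + m : ℕ) : ℂ) * ((p + m - 1).factorial : ℂ) := by
      rw [ht, Nat.factorial_succ, Nat.add_sub_cancel]; push_cast; ring
    have hc : (((p + m).choose m : ℕ) : ℂ) * ((p.factorial : ℂ) * (m.factorial : ℂ))
        = ((p + m).factorial : ℂ) := by
      have := Nat.add_choose_mul_factorial_mul_factorial p m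
      rw [← this, ← Nat.choose_symm_add]; push_cast; ring
    have h0 : ((p + m : ℕ) : ℂ) ≠ 0 := by exact_mod_cast (by omega : p + m ≠ 0)
    have h1 : ((p + m - 1).factorial : ℂ) ≠ 0 := by exact_mod_cast Nat.factorial_ne_zero _
    have h2 : (p.factorial : ℂ) ≠ 0 := by exact_mod_cast Nat.factorial_ne_zero _
    have h3 : (m.factorial : ℂ) ≠ 0 := by exact_mod_cast Nat.factorial_ne_zero _
    have hsq : ((-1 : ℂ) ^ m) * (-1) ^ m = 1 := by rw [← mul_pow]; simp
    have key : (-1 : ℂ) ^ (p + m) / ((p + m - 1).factorial : ℂ) * (((p + m : ℕ) : ℂ)⁻¹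
          * ((-1 : ℂ) ^ m * ((p + m).choose m : ℂ)))
        = (-1 : ℂ) ^ p / (p.factorial : ℂ) / (m.factorial : ℂ) := by
      rw [hf] at hc
      rw [pow_add]
      field_simp
      linear_combination (((p + m).choose m : ℂ) * p.factorial * m.factorial) * hsq + hc
    rw [← key]
    ring
  have h00 : ((if i = j then 1 else 0 : Alg R).1 φ).1 l = A 0 0 := by
    simp only [hA, chainMonomial_zero, hv, Nat.add_zero]
    split_ifs <;> simp
  have hps : ((vertexOp R C k₀ i j).1 φ).1 l
      = ∑ n ∈ Finset.range (l.length + 1), ∑ m ∈ Finset.range (n + 1), A m (n - m) := by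
    change ((partialSum R C k₀ i j l.length).1 φ).1 l = _
    rw [Finset.sum_range_succ', Finset.sum_range_one, ← h00, add_comm]
    simp only [partialSum, AddMemClass.coe_add, LinearMap.add_apply, Pi.add_apply]
    congr 1
    rw [Finset.range_eq_Ico, Finset.sum_Ico_add' (fun n => ∑ m ∈ Finset.range (n + 1), A m (n - m))]
    rw [zero_add, Finset.Ico_add_one_right_eq_Icc]
    simp only [AddSubmonoidClass.coe_finsetSum, LinearMap.sum_apply,
      Finset.sum_apply]
    exact Finset.sum_congr rfl fun n hn => hterm n (Finset.mem_Icc.mp hn).1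
  -- Sum over `p` at fixed `m`; there are enough values of `p` to complete each inner sum.
  rw [hps, Finset.sum_range_diag_flip]
  have hS : ∀ m ∈ Finset.range (l.length + 1), ∑ p ∈ Finset.range (l.length + 1 - m), A m p
      = if l.length = m then transferAmp K v l a φ.1 else 0 := by
    intro m hm
    have hm' := Finset.mem_range.mp hm
    have h := sum_chainMonomial_apply R hK v (l.length + 1 - m) m a φ l (by omega)
    have h3 : (m.factorial : ℂ) ≠ 0 := by exact_mod_cast Nat.factorial_ne_zero _
    have h4 : ∑ p ∈ Finset.range (l.length + 1 - m), A m p = (m.factorial : ℂ)⁻¹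
        * ∑ p ∈ Finset.range (l.length + 1 - m), (-1 : ℂ) ^ p / (p.factorial : ℂ)
          * ((chainMonomial R K v (p + m) m a).1 φ).1 l := by
      rw [Finset.mul_sum]
      refine Finset.sum_congr rfl fun p _ => ?_
      simp only [hA]
      ring
    rw [h4, h]
    split_ifs
    · field_simp
    · simp
  rw [Finset.sum_congr rfl hS]
  simp

/-! ### Products of two-body matrices with a common copy -/

/-- The matrix `A ⊗ 𝕀`, where the identity acts on an additional last copy. -/
def extendLast {N n : ℕ} (A : Matrix (Fin n → Fin N) (Fin n → Fin N) ℂ) :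
    Matrix (Fin (n + 1) → Fin N) (Fin (n + 1) → Fin N) ℂ :=
  fun x y => if x (Fin.last n) = y (Fin.last n) then
    A (fun p => x p.castSucc) (fun p => y p.castSucc) else 0

theorem extendLast_one {N n : ℕ} :
    extendLast (1 : Matrix (Fin n → Fin N) (Fin n → Fin N) ℂ) = 1 := by
  ext x y
  have h : x = y ↔ x (Fin.last n) = y (Fin.last n)
      ∧ (fun p : Fin n => x p.castSucc) = fun p => y p.castSucc := by
    constructor
    · rintro rfl; simp
    · rintro ⟨h1, h2⟩
      funext p
      induction p using Fin.lastCases with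
      | last => exact h1
      | cast p => exact congrFun h2 p
  simp only [extendLast, Matrix.one_apply, h, ite_and]

theorem extendLast_mul {N n : ℕ} (A B : Matrix (Fin n → Fin N) (Fin n → Fin N) ℂ) :
    extendLast (A * B) = extendLast A * extendLast B := by
  ext x y
  simp only [extendLast, Matrix.mul_apply]
  rw [sum_snoc]
  simp [Finset.sum_ite_irrel]

theorem extendLast_list_prod {N n : ℕ} (L : List (Matrix (Fin n → Fin N) (Fin n → Fin N) ℂ)) :
    extendLast L.prod = (L.map extendLast).prod := by
  induction L with
  | nil => simp [extendLast_one]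
  | cons A L ih => simp [extendLast_mul, ih]

theorem extendLast_leg {N n : ℕ} (M : TwoBody N) (p q : Fin n) :
    extendLast (leg M p q) = leg M p.castSucc q.castSucc := by
  ext x y
  have h : (∀ r, r ≠ p.castSucc → r ≠ q.castSucc → x r = y r) ↔ x (Fin.last n) = y (Fin.last n)
      ∧ ∀ r : Fin n, r ≠ p → r ≠ q → x r.castSucc = y r.castSucc := by
    rw [Fin.forall_fin_succ']
    simp [Fin.castSucc_inj, (Fin.castSucc_ne_last _).symm, and_comm]
  simp only [extendLast, leg]
  by_cases h1 : x (Fin.last n) = y (Fin.last n)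
  · by_cases h2 : ∀ r : Fin n, r ≠ p → r ≠ q → x r.castSucc = y r.castSucc
    · rw [if_pos h1, if_pos h2, if_pos (h.2 ⟨h1, h2⟩)]
    · rw [if_pos h1, if_neg h2, if_neg fun h3 => h2 (h.1 h3).2]
  · rw [if_neg h1, if_neg fun h3 => h1 (h.1 h3).1]

theorem extendLast_cons {N n : ℕ} (A : Matrix (Fin (n + 1) → Fin N) (Fin (n + 1) → Fin N) ℂ)
    (i j : Fin N) (α β : Fin (n + 1) → Fin N) :
    extendLast A (Fin.cons i α) (Fin.cons j β)
      = if α (Fin.last n) = β (Fin.last n) then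
          A (Fin.cons i (Fin.init α)) (Fin.cons j (Fin.init β)) else 0 := by
  have hinit : ∀ (a : Fin N) (γ : Fin (n + 1) → Fin N),
      (fun p : Fin (n + 1) => (Fin.cons a γ : Fin (n + 2) → Fin N) p.castSucc)
        = Fin.cons a (Fin.init γ) := by
    intro a γ
    funext p
    induction p using Fin.cases with
    | zero => rfl
    | succ p => rfl
  rw [← hinit, ← hinit]
  rfl

theorem prod_leg_succ {N : ℕ} (K : ℝ → TwoBody N) (n m : ℕ) (k : Fin (n + 1) → ℝ) :
    (((List.finRange (n + 1)).reverse.take (m + 1)).map fun p => leg (K (k p)) 0 p.succ).prod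
      = leg (K (k (Fin.last n))) 0 (Fin.last (n + 1)) * extendLast
        (((List.finRange n).reverse.take m).map fun p => leg (K (Fin.init k p)) 0 p.succ).prod := by
  rw [extendLast_list_prod, List.finRange_succ_last]
  simp [List.map_reverse, List.map_take, Function.comp_def, extendLast_leg, Fin.init]

/-- The matrix elements of `K₀ₙ(kₙ) ⋯ K₀,ₙ₋ₘ₊₁(kₙ₋ₘ₊₁)`. -/
theorem prod_leg_apply {N : ℕ} (K : ℝ → TwoBody N) (j : Fin N) (n : ℕ) :
    ∀ (m : ℕ) (i : Fin N) (k : Fin n → ℝ) (α β : Fin n → Fin N),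
      (((List.finRange n).reverse.take m).map fun p => leg (K (k p)) 0 p.succ).prod
          (Fin.cons i α) (Fin.cons j β)
        = legChain K (Pi.single j 1) n m i k α β := by
  induction n with
  | zero =>
    intro m i k α β
    simp [legChain, Matrix.one_apply, Pi.single_apply, Fin.cons_inj, Subsingleton.elim α β]
  | succ n ih =>
    intro m i k α β
    cases m with
    | zero =>
      have h := ih 0 i (Fin.init k) (Fin.init α) (Fin.init β)
      simp only [List.take_zero, List.map_nil, List.prod_nil] at h ⊢
      rw [← extendLast_one]
      refine (extendLast_cons 1 i j α β).trans ?_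
      simp only [legChain]
      rw [← h]
    | succ m =>
      have hlast : (Fin.cons i α : Fin (n + 2) → Fin N) (Fin.last (n + 1)) = α (Fin.last n) := rfl
      have hupd : ∀ c d : Fin N, Function.update (Function.update
            (Fin.cons i α : Fin (n + 2) → Fin N) 0 c) (Fin.last (n + 1)) d
          = Fin.cons c (Function.update α (Fin.last n) d) := by
        intro c d
        rw [Fin.update_cons_zero, ← Fin.succ_last, ← Fin.cons_update]
      rw [prod_leg_succ]
      refine (leg_mulVec _ (Fin.last_pos).ne (fun z => extendLast _ z (Fin.cons j β)) _).trans ?_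
      simp only [hupd, hlast, extendLast_cons, ih, Fin.cons_zero, Function.update_self,
        mul_ite, mul_zero, Finset.sum_ite_eq', Finset.mem_univ, if_true, legChain,
        Fin.init_update_last]

theorem leg_transpose {N : ℕ} {ι : Type} [Fintype ι] [DecidableEq ι] (M : TwoBody N) (p q : ι) :
    (leg M p q)ᵀ = leg (fun x y => M (y.2, y.1) (x.2, x.1)) q p := by
  ext x y
  simp only [Matrix.transpose_apply, leg]
  refine if_congr (forall_congr' fun r => ?_) rfl rfl
  rw [eq_comm (a := y r)]
  tauto

theorem prod_leg_dagger_apply {N : ℕ} (R : RMatrix N) (k₀ : ℝ) (n m : ℕ) (i j : Fin N)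
    (k : Fin n → ℝ) (α β : Fin n → Fin N) :
    (((List.finRange n).reverse.take m).reverse.map fun p => leg (R.mat (k p) k₀) p.succ 0).prod
        (Fin.cons i α) (Fin.cons j β)
      = legChain (daggerMat R k₀) (Pi.single i 1) n m j k α β := by
  rw [← legChain_swap]
  refine Eq.trans ?_ (prod_leg_apply (fun q x y => R.mat q k₀ (y.2, y.1) (x.2, x.1)) i n m j k β α)
  refine congrFun (congrFun (?_ : (List.prod _)ᵀ = List.prod _) _) _
  rw [Matrix.transpose_list_prod]
  simp only [← List.map_reverse, List.reverse_reverse, List.map_map, Function.comp_def,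
    leg_transpose]

/-! ### The operators `T` and `T†` on amplitudes -/

theorem vertexT_apply {N : ℕ} (R : RMatrix N) (k : ℝ) (i j : Fin N) (φ : Fock R)
    (l : List (ℝ × Fin N)) :
    ((vertexT R k i j).1 φ).1 l = transferAmp (R.mat k) (Pi.single j 1) l i φ.1 := by
  refine vertexOp_apply_eq_transferAmp R (intertwines_mat R k) _ _ k i j i
    (Pi.single_apply _ _ _) (fun n q α β => ?_) φ l
  simp only [coeffT, Matrix.smul_apply, Matrix.sum_apply, prod_leg_apply, smul_eq_mul]

theorem vertexTDagger_apply {N : ℕ} (R : RMatrix N) (k : ℝ) (i j : Fin N) (φ : Fock R)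
    (l : List (ℝ × Fin N)) :
    ((vertexTDagger R k i j).1 φ).1 l = transferAmp (daggerMat R k) (Pi.single i 1) l j φ.1 := by
  refine vertexOp_apply_eq_transferAmp R (intertwines_daggerMat R k) _ _ k i j j
    (by simp [Pi.single_apply, eq_comm]) (fun n q α β => ?_) φ l
  simp only [coeffTDagger, Matrix.smul_apply, Matrix.sum_apply, prod_leg_dagger_apply, smul_eq_mul]

/-! ### Well-bred operators -/

theorem Alg.ext_apply {N : ℕ} {R : RMatrix N} {X Y : Alg R}
    (h : ∀ (φ : Fock R) (l : List (ℝ × Fin N)), (X.1 φ).1 l = (Y.1 φ).1 l) : X = Y :=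
  Subtype.ext (LinearMap.ext fun φ => Subtype.ext (funext fun l => h φ l))

theorem vertexT_mul_ann {N : ℕ} (R : RMatrix N) (k₁ k₂ : ℝ) (i i' j : Fin N) :
    vertexT R k₁ i i' * ann R k₂ j
      = ∑ j'', ∑ i'', R.mat k₂ k₁ (j, i) (j'', i'') • (ann R k₂ j'' * vertexT R k₁ i'' i') := by
  refine Alg.ext_apply fun φ l => ?_
  simp only [MulMemClass.coe_mul, Module.End.mul_apply, AddSubmonoidClass.coe_finsetSum,
    SetLike.val_smul, LinearMap.smul_apply, LinearMap.sum_apply, Finset.sum_apply, Pi.smul_apply,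
    smul_eq_mul, ann_apply, vertexT_apply, transferAmp]
  exact (R.unit_comp k₂ k₁ j i
    (fun c d => transferAmp (R.mat k₁) (Pi.single i' 1) l d fun l' => φ.1 ((k₂, c) :: l'))).symm

/-- The second exchange relation is that of transfer operators with `createAmp`, for the vector
valued function `f(p) φ` placed in the component `j`. -/
theorem vertexT_mul_cre {N : ℕ} (R : RMatrix N) (k₁ : ℝ) (f : ℝ → ℂ) (i i' j : Fin N) :
    vertexT R k₁ i i' * cre R j f
      = ∑ i'', ∑ j'', cre R j'' (fun k₂ => f k₂ * R.mat k₁ k₂ (i, j'') (i'', j))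
          * vertexT R k₁ i'' i' := by
  refine Alg.ext_apply fun φ l => ?_
  have hcre : ∀ (j : Fin N) (f : ℝ → ℂ) (ψ : Fock R) (l : List (ℝ × Fin N)),
      ((cre R j f).1 ψ).1 l
        = createAmp R l fun p m l' => (if m = j then f p else 0) * ψ.1 l' := by
    intro j f ψ l
    rw [cre, intCre_apply]
    congr 1
    funext p m l'
    split_ifs <;> simp
  have h : (fun l' => ((cre R j f).1 φ).1 l')
      = fun l' => createAmp R l' fun p m l'' => (if m = j then f p else 0) * φ.1 l'' :=
    funext fun l' => hcre j f φ l'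
  simp only [MulMemClass.coe_mul, Module.End.mul_apply, AddSubmonoidClass.coe_finsetSum,
    LinearMap.sum_apply, Finset.sum_apply, vertexT_apply, hcre, ← createAmp_sum]
  refine (congrArg _ h).trans ?_
  rw [transferAmp_createAmp]
  congr 1
  funext p m l'
  simp only [transferAmp_smul]
  refine Finset.sum_congr rfl fun i'' _ => ?_
  simp only [ite_mul, zero_mul, mul_ite, mul_zero, Finset.sum_ite_eq', Finset.sum_ite_eq,
    Finset.mem_univ, if_true]
  ring

theorem wellBred_vertexT {N : ℕ} (R : RMatrix N) : WellBred R (vertexT R) :=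
  ⟨vertexT_mul_ann R, vertexT_mul_cre R⟩

/-- The first exchange relation determines all amplitudes of `L(k) φ` recursively from its vacuum
component, which is the same for all vertex operators. -/
theorem vertexOp_apply_of_wellBred {N : ℕ} (R : RMatrix N) (C : Coeff N)
    (h : WellBred R (vertexOp R C)) (k₀ : ℝ) (j : Fin N) (l : List (ℝ × Fin N)) :
    ∀ (i : Fin N) (φ : Fock R),
      ((vertexOp R C k₀ i j).1 φ).1 l = transferAmp (R.mat k₀) (Pi.single j 1) l i φ.1 := by
  induction l with
  | nil =>
    intro i φ
    change ((partialSum R C k₀ i j 0).1 φ).1 [] = _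
    simp only [partialSum, transferAmp, Pi.single_apply]
    split_ifs <;> simp
  | cons x l ih =>
    obtain ⟨k, c⟩ := x
    intro i φ
    rw [← R.unit_comp k₀ k i c (fun a b => ((vertexOp R C k₀ a j).1 φ).1 ((k, b) :: l))]
    simp only [transferAmp]
    refine Finset.sum_congr rfl fun a _ => Finset.sum_congr rfl fun b _ => ?_
    congr 1
    have hab := congrArg (fun X : Alg R => (X.1 φ).1 l) (h.1 k₀ k a j b)
    simp only [MulMemClass.coe_mul, Module.End.mul_apply, AddSubmonoidClass.coe_finsetSum,
      SetLike.val_smul, LinearMap.smul_apply, LinearMap.sum_apply, Finset.sum_apply, Pi.smul_apply,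
      smul_eq_mul, ann_apply] at hab
    rw [← hab, ih]
    rfl

theorem vertexOp_eq_vertexT {N : ℕ} (R : RMatrix N) (C : Coeff N)
    (h : WellBred R (vertexOp R C)) : vertexOp R C = vertexT R := by
  funext k₀
  refine Matrix.ext fun i j => Alg.ext_apply fun φ l => ?_
  rw [vertexOp_apply_of_wellBred R C h, vertexT_apply]

/-! ### The quantum group relations -/

theorem rttLeft_apply {N : ℕ} (R : RMatrix N) {A : Type} [Semiring A] [Algebra ℂ A]
    (T : ℝ → Matrix (Fin N) (Fin N) A) (k₁ k₂ : ℝ) (x y : Fin N × Fin N) :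
    rttLeft R T k₁ k₂ x y
      = ∑ a, ∑ b, R.mat k₁ k₂ x (a, b) • (T k₁ a y.1 * T k₂ b y.2) := by
  simp only [rttLeft, Matrix.mul_apply, Fintype.sum_prod_type, Matrix.kroneckerMap_apply,
    Matrix.map_apply, Matrix.one_apply]
  simp [Algebra.smul_def]
  simp only [Finset.sum_mul, mul_assoc]
  exact Finset.sum_comm

theorem rttRight_apply {N : ℕ} (R : RMatrix N) {A : Type} [Semiring A] [Algebra ℂ A]
    (T : ℝ → Matrix (Fin N) (Fin N) A) (k₁ k₂ : ℝ) (x y : Fin N × Fin N) :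
    rttRight R T k₁ k₂ x y
      = ∑ a, ∑ b, R.mat k₁ k₂ (a, b) y • (T k₂ x.2 b * T k₁ x.1 a) := by
  simp only [rttRight, Matrix.mul_apply, Fintype.sum_prod_type, Matrix.kroneckerMap_apply,
    Matrix.map_apply, Matrix.one_apply]
  simp [Algebra.smul_def, Algebra.commutes]

/-- Both sides acquire the same matrices from a further particle, by the Yang-Baxter equation. -/
theorem transferAmp_rtt {N : ℕ} (R : RMatrix N) (k₁ k₂ : ℝ) (j₁ j₂ : Fin N)
    (l : List (ℝ × Fin N)) :
    ∀ (i₁ i₂ : Fin N) (φ : Amp N),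
      ∑ a, ∑ b, R.mat k₁ k₂ (i₁, i₂) (a, b) * transferAmp (R.mat k₁) (Pi.single j₁ 1) l a
          (fun l' => transferAmp (R.mat k₂) (Pi.single j₂ 1) l' b φ)
        = ∑ a, ∑ b, R.mat k₁ k₂ (a, b) (j₁, j₂) * transferAmp (R.mat k₂) (Pi.single b 1) l i₂
          (fun l' => transferAmp (R.mat k₁) (Pi.single a 1) l' i₁ φ) := by
  induction l with
  | nil =>
    intro i₁ i₂ φ
    simp [transferAmp, Pi.single_apply]
  | cons x l ih =>
    obtain ⟨k, c⟩ := x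
    intro i₁ i₂ φ
    simp only [transferAmp]
    simp only [transferAmp_sum, transferAmp_smul]
    rw [R.ybe_comp k₁ k₂ k i₁ i₂ c (fun a b d => transferAmp (R.mat k₁) (Pi.single j₁ 1) l a
      (fun l' => transferAmp (R.mat k₂) (Pi.single j₂ 1) l' b fun l'' => φ ((k, d) :: l'')))]
    simp only [ih]
    simp only [Finset.mul_sum]
    simp only [← Fintype.sum_prod_type']
    refine Fintype.sum_equiv ⟨fun x => (x.2.2.2.2.1, x.2.2.2.2.2, x.1, x.2.1, x.2.2.1, x.2.2.2.1),
      fun y => (y.2.2.1, y.2.2.2.1, y.2.2.2.2.1, y.2.2.2.2.2, y.1, y.2.1),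
      fun _ => rfl, fun _ => rfl⟩ _ _ fun x => ?_
    simp only [Equiv.coe_fn_mk]
    ring

theorem rtt_vertexT {N : ℕ} (R : RMatrix N) (k₁ k₂ : ℝ) :
    rttLeft R (vertexT R) k₁ k₂ = rttRight R (vertexT R) k₁ k₂ := by
  refine Matrix.ext fun x y => Alg.ext_apply fun φ l => ?_
  rw [rttLeft_apply, rttRight_apply]
  have h := transferAmp_rtt R k₁ k₂ y.1 y.2 l x.1 x.2 φ.1
  have hf : ∀ k i j, ((vertexT R k i j).1 φ).1
      = fun l' => transferAmp (R.mat k) (Pi.single j 1) l' i φ.1 :=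
    fun k i j => funext fun l' => vertexT_apply R k i j φ l'
  simpa only [MulMemClass.coe_mul, Module.End.mul_apply, AddSubmonoidClass.coe_finsetSum,
    SetLike.val_smul, LinearMap.smul_apply, LinearMap.sum_apply, Finset.sum_apply, Pi.smul_apply,
    Submodule.coe_sum, Submodule.coe_smul, smul_eq_mul, vertexT_apply, hf] using h

theorem exists_algHom_UR {N : ℕ} (R : RMatrix N) :
    ∃ Φ : UR R →ₐ[ℂ] Alg R, ∀ k i j, Φ (UR.gen R k i j) = vertexT R k i j := by
  let f : FreeAlgebra ℂ (ℝ × Fin N × Fin N) →ₐ[ℂ] Alg R :=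
    FreeAlgebra.lift ℂ fun x => vertexT R x.1 x.2.1 x.2.2
  have hf : ∀ k i j, f (freeT N k i j) = vertexT R k i j := fun k i j => by simp [f, freeT]
  refine ⟨RingQuot.liftAlgHom ℂ ⟨f, ?_⟩, fun k i j => ?_⟩
  · rintro _ _ ⟨k₁, k₂, x, y⟩
    have h := congrFun (congrFun (rtt_vertexT R k₁ k₂) x) y
    simpa only [rttLeft_apply, rttRight_apply, map_sum, map_smul, map_mul, hf] using h
  · rw [UR.gen, RingQuot.liftAlgHom_mkAlgHom_apply, hf]

/-! ### Inverse and adjoint -/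

/-- In `R₀₁ ⋯ R₀ₙ Rₙ₀ ⋯ R₁₀` the factors belonging to the first particle are outermost, so that
those of the other particles are cancelled before them. -/
theorem transferAmp_transferAmp_dagger {N : ℕ} (R : RMatrix N) (k₀ : ℝ) (l : List (ℝ × Fin N)) :
    ∀ (i j : Fin N) (φ : Amp N),
      ∑ s, transferAmp (R.mat k₀) (Pi.single s 1) l i
          (fun l' => transferAmp (daggerMat R k₀) (Pi.single s 1) l' j φ)
        = if i = j then φ l else 0 := by
  induction l with
  | nil =>
    intro i j φ
    simp [transferAmp, Pi.single_apply]
  | cons x l ih =>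
    obtain ⟨k, c⟩ := x
    intro i j φ
    simp only [transferAmp]
    simp only [transferAmp_sum, transferAmp_smul]
    rw [← R.unit_comp k₀ k i c (fun a b => if a = j then φ ((k, b) :: l) else 0), Finset.sum_comm]
    refine Finset.sum_congr rfl fun i' _ => ?_
    rw [Finset.sum_comm]
    refine Finset.sum_congr rfl fun c' _ => ?_
    rw [← Finset.mul_sum]
    congr 1
    -- The induction hypothesis identifies the auxiliary indices next to the inner factors.
    have h : ∀ j' c'', ∑ s, daggerMat R k₀ k (j, c') (j', c'')
          * transferAmp (R.mat k₀) (Pi.single s 1) l i' (fun l' =>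
            transferAmp (daggerMat R k₀) (Pi.single s 1) l' j' fun l'' => φ ((k, c'') :: l''))
        = daggerMat R k₀ k (j, c') (j', c'') * if i' = j' then φ ((k, c'') :: l) else 0 :=
      fun j' c'' => by rw [← Finset.mul_sum, ih]
    rw [Finset.sum_comm, Finset.sum_congr rfl fun j' _ => Finset.sum_comm]
    simp only [h]
    simp [daggerMat]

/-- Here the factors belonging to the first particle are adjacent and cancel directly. -/
theorem transferAmp_dagger_transferAmp {N : ℕ} (R : RMatrix N) (k₀ : ℝ) (l : List (ℝ × Fin N)) :
    ∀ (i j : Fin N) (φ : Amp N),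
      ∑ s, transferAmp (daggerMat R k₀) (Pi.single i 1) l s
          (fun l' => transferAmp (R.mat k₀) (Pi.single j 1) l' s φ)
        = if i = j then φ l else 0 := by
  induction l with
  | nil =>
    intro i j φ
    simp [transferAmp, Pi.single_apply, eq_comm]
  | cons x l ih =>
    obtain ⟨k, c⟩ := x
    intro i j φ
    simp only [transferAmp]
    simp only [transferAmp_sum, transferAmp_smul]
    rw [← ih i j (fun l' => φ ((k, c) :: l')), Finset.sum_comm]
    refine Finset.sum_congr rfl fun j' _ => ?_
    rw [Finset.sum_comm]
    have h := R.unit_comp k k₀ c j' (fun d s' => transferAmp (daggerMat R k₀) (Pi.single i 1) l j'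
      fun l' => transferAmp (R.mat k₀) (Pi.single j 1) l' s' fun l'' => φ ((k, d) :: l''))
    exact h

theorem vertexT_mul_vertexTDagger {N : ℕ} (R : RMatrix N) (k : ℝ) :
    vertexT R k * vertexTDagger R k = 1 := by
  refine Matrix.ext fun i j => Alg.ext_apply fun φ l => ?_
  have hf : ∀ i j, ((vertexTDagger R k i j).1 φ).1
      = fun l' => transferAmp (daggerMat R k) (Pi.single i 1) l' j φ.1 :=
    fun i j => funext fun l' => vertexTDagger_apply R k i j φ l'
  have h := transferAmp_transferAmp_dagger R k l i j φ.1
  simp only [Matrix.mul_apply, MulMemClass.coe_mul, Module.End.mul_apply,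
    AddSubmonoidClass.coe_finsetSum, LinearMap.sum_apply, Finset.sum_apply,
    vertexT_apply, hf, h, Matrix.one_apply]
  split_ifs <;> simp

theorem vertexTDagger_mul_vertexT {N : ℕ} (R : RMatrix N) (k : ℝ) :
    vertexTDagger R k * vertexT R k = 1 := by
  refine Matrix.ext fun i j => Alg.ext_apply fun φ l => ?_
  have hf : ∀ i j, ((vertexT R k i j).1 φ).1
      = fun l' => transferAmp (R.mat k) (Pi.single j 1) l' i φ.1 :=
    fun i j => funext fun l' => vertexT_apply R k i j φ l'
  have h := transferAmp_dagger_transferAmp R k l i j φ.1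
  simp only [Matrix.mul_apply, MulMemClass.coe_mul, Module.End.mul_apply,
    AddSubmonoidClass.coe_finsetSum, LinearMap.sum_apply, Finset.sum_apply,
    vertexTDagger_apply, hf, h, Matrix.one_apply]
  split_ifs <;> simp

/-- Hermitian analyticity of the `R`-matrix in components. -/
theorem conj_mat {N : ℕ} {R : RMatrix N}
    (hR : ∀ k₁ k₂, (leg (R.mat k₁ k₂) (0 : Fin 2) 1)ᴴ = leg (R.mat k₂ k₁) (1 : Fin 2) 0)
    (k₁ k₂ : ℝ) (a b c d : Fin N) :
    conj (R.mat k₁ k₂ (a, b) (c, d)) = R.mat k₂ k₁ (d, c) (b, a) := by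
  have h := congrFun (congrFun (hR k₁ k₂) ![c, d]) ![a, b]
  simpa [leg, Fin.forall_fin_two] using h

theorem leg_conjTranspose {N : ℕ} {R : RMatrix N}
    (hR : ∀ k₁ k₂, (leg (R.mat k₁ k₂) (0 : Fin 2) 1)ᴴ = leg (R.mat k₂ k₁) (1 : Fin 2) 0)
    {ι : Type} [Fintype ι] [DecidableEq ι] (k₁ k₂ : ℝ) (p q : ι) :
    (leg (R.mat k₁ k₂) p q)ᴴ = leg (R.mat k₂ k₁) q p := by
  ext x y
  simp only [Matrix.conjTranspose_apply, leg]
  rw [apply_ite star, star_zero]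
  refine if_congr (forall_congr' fun r => ?_) (conj_mat hR _ _ _ _ _ _) rfl
  rw [eq_comm (a := y r)]
  tauto

theorem coeffTDagger_eq_conjTranspose {N : ℕ} {R : RMatrix N}
    (hR : ∀ k₁ k₂, (leg (R.mat k₁ k₂) (0 : Fin 2) 1)ᴴ = leg (R.mat k₂ k₁) (1 : Fin 2) 0)
    (n : ℕ) (k₀ : ℝ) (k : Fin n → ℝ) : coeffTDagger R n k₀ k = (coeffT R n k₀ k)ᴴ := by
  simp only [coeffT, coeffTDagger, Matrix.conjTranspose_smul, Matrix.conjTranspose_sum,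
    Matrix.conjTranspose_list_prod, List.map_map, Function.comp_def, leg_conjTranspose hR,
    List.map_reverse]
  simp

/-- At fixed spectral parameters the transfer operators for `R` and for its dagger are adjoint to
each other with respect to the sum over the internal indices. -/
theorem sum_conj_mul_transferAmp {N : ℕ} {R : RMatrix N}
    (hR : ∀ k₁ k₂, (leg (R.mat k₁ k₂) (0 : Fin 2) 1)ᴴ = leg (R.mat k₂ k₁) (1 : Fin 2) 0)
    (k₀ : ℝ) (j : Fin N) (n : ℕ) :
    ∀ (i : Fin N) (φ ψ : Amp N) (k : Fin n → ℝ),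
      ∑ α : Fin n → Fin N, conj (φ (List.ofFn fun p => (k p, α p)))
          * transferAmp (R.mat k₀) (Pi.single j 1) (List.ofFn fun p => (k p, α p)) i ψ
        = ∑ α : Fin n → Fin N,
          conj (transferAmp (daggerMat R k₀) (Pi.single j 1) (List.ofFn fun p => (k p, α p)) i φ)
            * ψ (List.ofFn fun p => (k p, α p)) := by
  have hcons : ∀ (n : ℕ) (f : (Fin (n + 1) → Fin N) → ℂ),
      ∑ α, f α = ∑ c : Fin N, ∑ α : Fin n → Fin N, f (Fin.cons c α) := by
    intro n f
    rw [← Fintype.sum_prod_type']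
    exact (Fintype.sum_equiv (Fin.consEquiv fun _ => Fin N) _ _ fun _ => rfl).symm
  induction n with
  | zero =>
    intro i φ ψ k
    simp [transferAmp, Pi.single_apply, apply_ite conj]
  | succ n ih =>
    intro i φ ψ k
    simp only [hcons, List.ofFn_succ, Fin.cons_zero, Fin.cons_succ, transferAmp]
    have h := fun i' c c' => ih i' (fun l' => φ ((k 0, c) :: l')) (fun l' => ψ ((k 0, c') :: l'))
      (fun p => k p.succ)
    have hL : ∀ c, ∑ α : Fin n → Fin N, conj (φ ((k 0, c) :: List.ofFn fun p => (k p.succ, α p)))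
          * ∑ i', ∑ c', R.mat k₀ (k 0) (i, c) (i', c') * transferAmp (R.mat k₀) (Pi.single j 1)
            (List.ofFn fun p => (k p.succ, α p)) i' (fun l' => ψ ((k 0, c') :: l'))
        = ∑ i', ∑ c', R.mat k₀ (k 0) (i, c) (i', c') * ∑ α : Fin n → Fin N,
          conj (φ ((k 0, c) :: List.ofFn fun p => (k p.succ, α p)))
            * transferAmp (R.mat k₀) (Pi.single j 1) (List.ofFn fun p => (k p.succ, α p)) i'
              (fun l' => ψ ((k 0, c') :: l')) := by
      intro c
      simp only [Finset.mul_sum]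
      rw [Finset.sum_comm]
      refine Finset.sum_congr rfl fun i' _ => ?_
      rw [Finset.sum_comm]
      simp only [mul_left_comm]
    have hR' : ∀ c', ∑ α : Fin n → Fin N,
          conj (∑ i', ∑ c, daggerMat R k₀ (k 0) (i, c') (i', c) * transferAmp (daggerMat R k₀)
            (Pi.single j 1) (List.ofFn fun p => (k p.succ, α p)) i' (fun l' => φ ((k 0, c) :: l')))
          * ψ ((k 0, c') :: List.ofFn fun p => (k p.succ, α p))
        = ∑ i', ∑ c, R.mat k₀ (k 0) (i, c) (i', c') * ∑ α : Fin n → Fin N,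
          conj (transferAmp (daggerMat R k₀) (Pi.single j 1)
              (List.ofFn fun p => (k p.succ, α p)) i' (fun l' => φ ((k 0, c) :: l')))
            * ψ ((k 0, c') :: List.ofFn fun p => (k p.succ, α p)) := by
      intro c'
      simp only [map_sum, map_mul, daggerMat, conj_mat hR, Finset.sum_mul, Finset.mul_sum]
      rw [Finset.sum_comm]
      refine Finset.sum_congr rfl fun i' _ => ?_
      rw [Finset.sum_comm]
      simp only [mul_assoc]
    simp only [hL, hR', h]
    rw [Finset.sum_comm]
    conv_rhs => rw [Finset.sum_comm]
    exact Finset.sum_congr rfl fun i' _ => Finset.sum_comm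

theorem isAdjointOf_vertexTDagger {N : ℕ} {R : RMatrix N}
    (hR : ∀ k₁ k₂, (leg (R.mat k₁ k₂) (0 : Fin 2) 1)ᴴ = leg (R.mat k₂ k₁) (1 : Fin 2) 0)
    (k : ℝ) (i j : Fin N) : IsAdjointOf (vertexTDagger R k j i) (vertexT R k i j) := by
  intro φ ψ _ _
  -- The integrands of the two scalar products coincide at each point.
  simp only [fockInner, sector, vertexT_apply, vertexTDagger_apply,
    sum_conj_mul_transferAmp hR k j _ i φ.1 ψ.1]

end ZF

end

theorem mainTheorem3 (N : ℕ) (R : ZF.RMatrix N) :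
    -- the explicit series `T(k)` is well-bred
    ZF.WellBred R (ZF.vertexT R) ∧
    -- uniqueness: it is the only series of this form which is well-bred
    (∀ C : ZF.Coeff N, ZF.WellBred R (ZF.vertexOp R C) → ZF.vertexOp R C = ZF.vertexT R) ∧
    -- the quantum group relations
    (∀ k₁ k₂, ZF.rttLeft R (ZF.vertexT R) k₁ k₂ = ZF.rttRight R (ZF.vertexT R) k₁ k₂) ∧
    -- realization of the quantum group inside the ZF algebra
    (∃ Φ : ZF.UR R →ₐ[ℂ] ZF.Alg R, ∀ k i j, Φ (ZF.UR.gen R k i j) = ZF.vertexT R k i j) ∧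
    -- `T†(k) = T(k)⁻¹`
    (∀ k, ZF.vertexT R k * ZF.vertexTDagger R k = 1 ∧ ZF.vertexTDagger R k * ZF.vertexT R k = 1) ∧
    -- if `R₂₁(k₂,k₁)` is the Hermitian conjugate of `R₁₂(k₁,k₂)`, then `†` is the genuine adjoint
    ((∀ k₁ k₂, (ZF.leg (R.mat k₁ k₂) (0 : Fin 2) 1)ᴴ = ZF.leg (R.mat k₂ k₁) (1 : Fin 2) 0) →
      (∀ n k₀ k, ZF.coeffTDagger R n k₀ k = (ZF.coeffT R n k₀ k)ᴴ) ∧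
      ∀ k i j, ZF.IsAdjointOf (ZF.vertexTDagger R k j i) (ZF.vertexT R k i j)) := by
  exact ⟨ZF.wellBred_vertexT R, ZF.vertexOp_eq_vertexT R, ZF.rtt_vertexT R, ZF.exists_algHom_UR R,
    fun k => ⟨ZF.vertexT_mul_vertexTDagger R k, ZF.vertexTDagger_mul_vertexT R k⟩,
    fun hR => ⟨ZF.coeffTDagger_eq_conjTranspose hR, ZF.isAdjointOf_vertexTDagger hR⟩⟩
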